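/- Let $\varepsilon>0$, $L>0$ and $\widehat{\mathcal U}_0\in\mathbb R$, let $V(\theta)=-\varepsilon\cos 2\theta$, and consider the energy $$\mathscr E[\theta]=\int_0^L \tfrac12(\theta'-\widehat{\mathcal U}_0)^2-V(\theta)\,\mathrm dR .$$ An equilibrium is a solution on $[0,L]$ of $\theta''+2\varepsilon\sin 2\theta=0$ with $\theta'(0)=\theta'(L)=\widehat{\mathcal U}_0$; it is stable if it minimizes $\mathscr E$ among all $C^1$ functions on $[0,L]$ in some $C^1$-neighbourhood of it. A perversion is a solution $\theta$ of $\theta''+2\varepsilon\sin2\theta=0$ on $[0,L]$ such that $\theta(L-R)=-\theta(R)$ for all $R\in[0,L]$ and $\theta'(R)\neq0$ for all $R\in(0,L)$ (no boundary condition on $\theta'$ is imposed). Its pseudo-energy $E=\frac12\theta'^2+V(\theta)$ is constant, and its parameter is $\nu=\frac12(E/\varepsilon-1)$. It is free of flange contact if $|\theta(R)|<\pi$ for all $R\in[0,L]$. Its stability index $J$ is the number of $R\in[0,L]$ at which $\theta(R)$ is a nondegenerate minimum point of $V$ minus the number of $R\in[0,L]$ at which $\theta(R)$ is a nondegenerate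 maximum point of $V$. Let $\mathrm{cn}(u|m)$ be the Jacobi elliptic cosine with parameter $m$, $K(m)=\int_0^{\pi/2}(1-m\sin^2t)^{-1/2}\,\mathrm dt$ for $m<1$, and $k(\nu)=K\!\left(\frac1{1+\nu}\right)/\sqrt{1+\nu}$ for $\nu>0$. Call $\nu$ admissible if $$\nu>0\quad\text{and}\quad \frac{\sqrt\varepsilon L}{2}<k(\nu)<\sqrt\varepsilon L. \qquad (\ast)$$ Then: 1. Every perversion has a parameter $\nu>-1$. 2. Let $\theta$ be a perversion with parameter $\nu$. Then $\theta$ or its mirror image $-\theta$ is an equilibrium if and only if $$\nu+\mathrm{cn}^2\!\left(\sqrt\varepsilon L\sqrt{1+\nu}\,\Big|\,\tfrac1{1+\nu}\right)=\frac{\widehat{\mathcal U}_0^2}{4\varepsilon}, \qquad (\ast\ast)$$ and $\theta$ itself is an equilibrium if and only if $(\ast\ast)$ holds and $\widehat{\mathcal U}_0\,\theta(L)\ge0$. 3. Let $\theta$ be a perversion with parameter $\nu$. Then $J=-1$, $|\theta(L)|\neq\pi/2$ and $\theta$ is free of flange contact if and only if $\nu$ is admissible. If moreover $\theta$ is an equilibrium,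 then it is stable and free of flange contact if and only if $\nu$ is admissible. 4. The function $k$ is strictly decreasing on $(0,\infty)$, and the set of admissible $\nu$ is a non-empty open interval $(\nu_1,\nu_2)$ with $\nu_1>0$, $k(\nu_1)=\sqrt\varepsilon L$ and $k(\nu_2)=\sqrt\varepsilon L/2$. 5. For every real $\nu$, there is a perversion with parameter $\nu$ that is a stable equilibrium free of flange contact if and only if $\nu$ satisfies $(\ast)$ and $(\ast\ast)$. -/

import Mathlib

noncomputable section

/-- Incomplete elliptic integral of the first kind `F(φ | m)`, with parameter `m`. -/
def ellipticF (φ m : ℝ) : ℝ :=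
  ∫ t in (0 : ℝ)..φ, 1 / Real.sqrt (1 - m * Real.sin t ^ 2)

/-- Complete elliptic integral of the first kind `K(m) = F(π/2 | m)`, for `m < 1`. -/
def ellipticK (m : ℝ) : ℝ := ellipticF (Real.pi / 2) m

/-- The largest interval around `0` on which the integrand of `F(· | m)` is regular: all of `ℝ`
if `m < 1`, and `(-π/2, π/2)` if `m = 1`. -/
def ellipticDomain (m : ℝ) : Set ℝ :=
  {φ | ∀ t ∈ Set.uIcc 0 φ, m * Real.sin t ^ 2 < 1}

/-- Jacobi amplitude `am(u | m)` for `m ≤ 1`: the inverse of `F(· | m)`, which is then a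
bijection from `ellipticDomain m` onto `ℝ`. -/
def jacobiAm (u m : ℝ) : ℝ :=
  Function.invFunOn (fun φ => ellipticF φ m) (ellipticDomain m) u

/-- Jacobi `dn(u | m)` for `m ≤ 1`. -/
def jacobiDn (u m : ℝ) : ℝ := Real.sqrt (1 - m * Real.sin (jacobiAm u m) ^ 2)

/-- Jacobi elliptic cosine `cn(u | m)` for real `u` and every real parameter `m`.
For `m > 1` it is given by the reciprocal-parameter identity `cn(u | m) = dn(√m u | 1/m)`. -/
def jacobiCn (u m : ℝ) : ℝ :=
  if m ≤ 1 then Real.cos (jacobiAm u m) else jacobiDn (Real.sqrt m * u) (1 / m)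

namespace Ladder

/-- The potential `V(θ) = -ε cos 2θ`. -/
def V (ε θ : ℝ) : ℝ := -ε * Real.cos (2 * θ)

/-- The derivative `θ'` of a function on `[0, L]` (one-sided at the end points). -/
def slope (L : ℝ) (θ : ℝ → ℝ) (R : ℝ) : ℝ := derivWithin θ (Set.Icc 0 L) R

/-- The non-dimensional energy `∫₀ᴸ ½ (θ' - U₀)² - V(θ) dR`. -/
def energy (ε L U₀ : ℝ) (θ : ℝ → ℝ) : ℝ :=
  ∫ R in (0 : ℝ)..L, ((slope L θ R - U₀) ^ 2 / 2 - V ε (θ R))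

/-- `θ` is a twice differentiable solution of `θ'' + 2 ε sin 2θ = 0` on `[0, L]`. -/
def IsSolution (ε L : ℝ) (θ : ℝ → ℝ) : Prop :=
  DifferentiableOn ℝ θ (Set.Icc 0 L) ∧
  ∀ R ∈ Set.Icc 0 L,
    HasDerivWithinAt (slope L θ) (-(2 * ε * Real.sin (2 * θ R))) (Set.Icc 0 L) R

/-- Equilibria: solutions of the Euler-Lagrange equation with the natural boundary conditions. -/
def IsEquilibrium (ε L U₀ : ℝ) (θ : ℝ → ℝ) : Prop :=
  IsSolution ε L θ ∧ slope L θ 0 = U₀ ∧ slope L θ L = U₀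

/-- Local minimality of the energy among all `C¹` functions on `[0, L]` (with free end points)
that are close to `θ` in the `C¹` norm. -/
def IsLocalMinimizer (ε L U₀ : ℝ) (θ : ℝ → ℝ) : Prop :=
  ∃ δ > 0, ∀ η : ℝ → ℝ, ContDiffOn ℝ 1 η (Set.Icc 0 L) →
    (∀ R ∈ Set.Icc 0 L, |η R - θ R| < δ ∧ |slope L η R - slope L θ R| < δ) →
    energy ε L U₀ θ ≤ energy ε L U₀ η

/-- Stable equilibria: equilibria that locally minimize the energy. -/
def IsStable (ε L U₀ : ℝ) (θ : ℝ → ℝ) : Prop :=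
  IsEquilibrium ε L U₀ θ ∧ IsLocalMinimizer ε L U₀ θ

/-- Perversions of length `L` (no boundary condition is imposed). -/
def IsPerversion (ε L : ℝ) (θ : ℝ → ℝ) : Prop :=
  IsSolution ε L θ ∧ (∀ R ∈ Set.Icc 0 L, θ (L - R) = -θ R) ∧
  ∀ R ∈ Set.Ioo 0 L, slope L θ R ≠ 0

/-- The pseudo-energy `E = θ'² / 2 + V(θ)` at the point `R`. -/
def pseudoEnergy (ε L : ℝ) (θ : ℝ → ℝ) (R : ℝ) : ℝ :=
  slope L θ R ^ 2 / 2 + V ε (θ R)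

/-- `ν = (E / ε - 1) / 2` is the pseudo-energy parameter of `θ`. -/
def HasParameter (ε L : ℝ) (θ : ℝ → ℝ) (ν : ℝ) : Prop :=
  ∀ R ∈ Set.Icc 0 L, ν = (pseudoEnergy ε L θ R / ε - 1) / 2

/-- Vertical lines of the phase plane at the minimal points of `V`. -/
def GammaMin (ε : ℝ) : Set (ℝ × ℝ) :=
  {p | deriv (V ε) p.1 = 0 ∧ 0 < deriv (deriv (V ε)) p.1}

/-- Vertical lines of the phase plane at the maximal points of `V`. -/
def GammaMax (ε : ℝ) : Set (ℝ × ℝ) :=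
  {p | deriv (V ε) p.1 = 0 ∧ deriv (deriv (V ε)) p.1 < 0}

/-- The stability index of the phase-plane trajectory `R ↦ (θ(R), θ'(R))`, `R ∈ [0, L]`. -/
def stabilityIndex (ε L : ℝ) (θ : ℝ → ℝ) : ℤ :=
  ({R ∈ Set.Icc 0 L | (θ R, slope L θ R) ∈ GammaMin ε}.ncard : ℤ) -
  ({R ∈ Set.Icc 0 L | (θ R, slope L θ R) ∈ GammaMax ε}.ncard : ℤ)

/-- Absence of hard contact between the flanges. -/
def NoFlangeContact (L : ℝ) (θ : ℝ → ℝ) : Prop :=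
  ∀ R ∈ Set.Icc 0 L, |θ R| < Real.pi

/-- The function `k(ν) = K(1/(1+ν)) / √(1+ν)`, for `ν > 0`. -/
def k (ν : ℝ) : ℝ := ellipticK (1 / (1 + ν)) / Real.sqrt (1 + ν)

/-- The equation `ν + cn²(√ε L √(1+ν) | 1/(1+ν)) = U₀² / (4 ε)`. -/
def EquilibriumEquation (ε L U₀ ν : ℝ) : Prop :=
  ν + jacobiCn (Real.sqrt ε * L * Real.sqrt (1 + ν)) (1 / (1 + ν)) ^ 2 = U₀ ^ 2 / (4 * ε)

/-- The inequalities `√ε L / 2 < k(ν) < √ε L`, where `ν > 0` makes `k(ν)` real and finite. -/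
def Admissible (ε L ν : ℝ) : Prop :=
  0 < ν ∧ Real.sqrt ε * L / 2 < k ν ∧ k ν < Real.sqrt ε * L

end Ladder

end

/-! A perversion vanishes at `L / 2` and, up to the reflection `θ ↦ -θ`, increases on `[0, L]` from
`-θ L` to `θ L`; everything is governed by the amplitude `θ L`. Conservation of pseudo-energy reads
`θ'² = 4ε(ν + cos² θ)`. At the midpoint this forces `ν > -1`; at the two ends it gives equal slopes,
so being an equilibrium is one condition on `θ'(L)`. ODE uniqueness identifies `θ` with a translated
Jacobi amplitude (or its reciprocal-modulus form when `ν < 0`), which turns `cos² (θ L)` into `cn²`.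

For `ν > 0` the same identification gives `F(θ L | 1/(1+ν)) = √ε L √(1+ν)`. Since `F(π/2) = K`,
`F(π) = 2K` and `F` increases, admissibility means exactly `π/2 < θ L < π`; for `ν ≤ 0` the
amplitude cannot exceed `π/2`. Counting crossings of `0` and `±π/2` then settles the index.

Stability depends on the second variation `∫ h'² - 4ε cos(2θ) h²` with free ends, and `θ'` solves
its Jacobi equation. If `π/2 < θ L < π`, the Riccati solution `θ''/θ'` has strictly favourable signs
at both ends, and a small perturbation of it makes the Riccati inequality strict
(`isStable_of_pos`). If `θ L < π/2`, the signs are reversed and the direction `θ' + s` lowers the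
energy (`not_isLocalMinimizer_of_lt`). If `θ L = π/2`, the energy density is `L`-periodic, so
translates have equal energy; they violate the natural boundary conditions and can therefore be
improved (`not_isLocalMinimizer_of_eq`).

Finally, `k` decreases continuously from `∞` to `0` on the positive half-line, which yields the
interval of admissible parameters. -/

noncomputable section

open Set

/-! ### Elliptic integral, Jacobi amplitude and `dn` for `0 ≤ m ≤ 1`. -/

section Elliptic

theorem measurable_ellipticF_integrand (m : ℝ) :
    Measurable fun t => 1 / Real.sqrt (1 - m * Real.sin t ^ 2) := by fun_prop

theorem ellipticF_zero (m : ℝ) : ellipticF 0 m = 0 := by simp [ellipticF]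

theorem ellipticF_neg (φ m : ℝ) : ellipticF (-φ) m = -ellipticF φ m := by
  have h := intervalIntegral.integral_comp_neg (a := 0) (b := φ)
    (fun t => 1 / Real.sqrt (1 - m * Real.sin t ^ 2))
  simp only [Real.sin_neg, neg_sq, neg_zero] at h
  rw [ellipticF, ellipticF, h, intervalIntegral.integral_symm]

theorem zero_mem_ellipticDomain (m : ℝ) : (0 : ℝ) ∈ ellipticDomain m := by
  intro t ht
  have : t = 0 := by simpa using ht
  simp [this]

theorem neg_mem_ellipticDomain {φ m : ℝ} (h : φ ∈ ellipticDomain m) :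
    -φ ∈ ellipticDomain m := by
  intro t ht
  have := h (-t) (by
    rw [mem_uIcc] at ht ⊢
    rcases ht with h | h
    · right; constructor <;> linarith [h.1, h.2]
    · left; constructor <;> linarith [h.1, h.2])
  simpa using this

theorem mul_sin_sq_lt_one_of_mem {φ m : ℝ} (h : φ ∈ ellipticDomain m) :
    m * Real.sin φ ^ 2 < 1 := h φ right_mem_uIcc

theorem hasDerivAt_ellipticF {φ m : ℝ} (hφ : φ ∈ ellipticDomain m) :
    HasDerivAt (fun x => ellipticF x m) (1 / Real.sqrt (1 - m * Real.sin φ ^ 2)) φ := by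
  have hc : ∀ t, m * Real.sin t ^ 2 < 1 →
      ContinuousAt (fun t => 1 / Real.sqrt (1 - m * Real.sin t ^ 2)) t := by
    intro t ht
    refine ContinuousAt.div continuousAt_const (by fun_prop) ?_
    exact (Real.sqrt_pos.2 (by linarith)).ne'
  refine intervalIntegral.integral_hasDerivAt_right ?_ ?_ (hc φ (mul_sin_sq_lt_one_of_mem hφ))
  · exact ContinuousOn.intervalIntegrable fun t ht => (hc t (hφ t ht)).continuousWithinAt
  · exact (measurable_ellipticF_integrand m).stronglyMeasurable.stronglyMeasurableAtFilter

theorem ellipticDomain_of_lt_one {m : ℝ} (hm : 0 ≤ m) (hm1 : m < 1) :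
    ellipticDomain m = univ := by
  refine eq_univ_of_forall fun φ t _ => ?_
  nlinarith [Real.sin_sq_le_one t, sq_nonneg (Real.sin t)]

theorem ellipticDomain_one : ellipticDomain 1 = Ioo (-(Real.pi / 2)) (Real.pi / 2) := by
  have hpi := Real.pi_pos
  ext φ
  constructor
  · intro h
    constructor
    · by_contra! hc
      have := h (-(Real.pi / 2)) (by rw [mem_uIcc]; right; constructor <;> linarith)
      norm_num at this
    · by_contra! hc
      have := h (Real.pi / 2) (by rw [mem_uIcc]; left; constructor <;> linarith)
      norm_num at this
  · intro h t ht
    have : 0 < Real.cos t := by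
      apply Real.cos_pos_of_mem_Ioo
      rw [mem_uIcc] at ht
      rcases ht with h' | h' <;> constructor <;> linarith [h.1, h.2, h'.1, h'.2]
    nlinarith [Real.sin_sq_add_cos_sq t]

theorem convex_isOpen_ellipticDomain {m : ℝ} (hm : 0 ≤ m) (hm1 : m ≤ 1) :
    Convex ℝ (ellipticDomain m) ∧ IsOpen (ellipticDomain m) := by
  rcases hm1.lt_or_eq with h | rfl
  · rw [ellipticDomain_of_lt_one hm h]; exact ⟨convex_univ, isOpen_univ⟩
  · rw [ellipticDomain_one]; exact ⟨convex_Ioo _ _, isOpen_Ioo⟩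

/-- The integrand is at least `1`. This one bound gives strict monotonicity, surjectivity for `m <
1`, and the 1-Lipschitz continuity of the inverse. -/
theorem sub_le_ellipticF_sub {m : ℝ} (hm : 0 ≤ m) (hm1 : m ≤ 1) {a b : ℝ}
    (ha : a ∈ ellipticDomain m) (hb : b ∈ ellipticDomain m) (hab : a ≤ b) :
    b - a ≤ ellipticF b m - ellipticF a m := by
  obtain ⟨hconv, hopen⟩ := convex_isOpen_ellipticDomain hm hm1
  have := hconv.mul_sub_le_image_sub_of_le_deriv (f := fun x => ellipticF x m) (C := 1)
    (fun x hx => (hasDerivAt_ellipticF hx).continuousAt.continuousWithinAt)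
    (fun x hx => (hasDerivAt_ellipticF (interior_subset hx)).differentiableAt.differentiableWithinAt)
    (fun x hx => by
      rw [(hasDerivAt_ellipticF (interior_subset hx)).deriv]
      have h1 := mul_sin_sq_lt_one_of_mem (interior_subset hx)
      rw [le_div_iff₀ (Real.sqrt_pos.2 (by linarith)), one_mul]
      exact Real.sqrt_le_one.2 (by nlinarith [sq_nonneg (Real.sin x)])) a ha b hb hab
  linarith

theorem ellipticF_strictMonoOn {m : ℝ} (hm : 0 ≤ m) (hm1 : m ≤ 1) :
    StrictMonoOn (fun x => ellipticF x m) (ellipticDomain m) := by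
  intro a ha b hb hab
  have := sub_le_ellipticF_sub hm hm1 ha hb hab.le
  simp only
  linarith

/-- For `m = 1` the domain is bounded, so the expansion bound does not give surjectivity; the
Gudermannian function is an explicit inverse instead. -/
theorem ellipticF_arctan_sinh (u : ℝ) : ellipticF (Real.arctan (Real.sinh u)) 1 = u := by
  have hmem : ∀ u, Real.arctan (Real.sinh u) ∈ ellipticDomain 1 := fun u => by
    rw [ellipticDomain_one]
    exact ⟨Real.neg_pi_div_two_lt_arctan _, Real.arctan_lt_pi_div_two _⟩
  have hd : ∀ u, HasDerivAt (fun u => ellipticF (Real.arctan (Real.sinh u)) 1 - u) 0 u := by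
    intro u
    have h1 := (hasDerivAt_ellipticF (hmem u)).comp u (Real.hasDerivAt_sinh u).arctan
    refine (h1.sub (hasDerivAt_id u)).congr_deriv ?_
    have hc := Real.cosh_pos u
    have h2 : 1 - 1 * Real.sin (Real.arctan (Real.sinh u)) ^ 2 = (1 / Real.cosh u) ^ 2 := by
      have := Real.sin_sq_add_cos_sq (Real.arctan (Real.sinh u))
      rw [Real.cos_sq_arctan, add_comm 1 (Real.sinh u ^ 2), ← Real.cosh_sq] at this
      rw [div_pow, one_pow]; linarith
    rw [h2, Real.sqrt_sq (by positivity), add_comm 1 (Real.sinh u ^ 2), ← Real.cosh_sq]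
    field_simp
    ring
  have := is_const_of_deriv_eq_zero (fun u => (hd u).differentiableAt) (fun u => (hd u).deriv) u 0
  simp [ellipticF_zero] at this
  linarith

theorem exists_ellipticF_eq {m : ℝ} (hm : 0 ≤ m) (hm1 : m ≤ 1) (u : ℝ) :
    ∃ φ ∈ ellipticDomain m, ellipticF φ m = u := by
  rcases hm1.lt_or_eq with h | rfl
  · have hdom := ellipticDomain_of_lt_one hm h
    have hmem : ∀ x, x ∈ ellipticDomain m := fun x => by rw [hdom]; trivial
    have hcont : Continuous fun x => ellipticF x m :=
      continuous_iff_continuousAt.2 fun x => (hasDerivAt_ellipticF (hmem x)).continuousAt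
    have key : ∀ a b : ℝ, a ≤ b → b - a ≤ ellipticF b m - ellipticF a m := fun a b hab =>
      sub_le_ellipticF_sub hm hm1 (hmem a) (hmem b) hab
    have h0 := ellipticF_zero m
    obtain ⟨φ, hφ⟩ := mem_range_of_exists_le_of_exists_ge (c := u) hcont
      ⟨-|u|, by have := key (-|u|) 0 (by simp); linarith [neg_abs_le u]⟩
      ⟨|u|, by have := key 0 |u| (by simp); linarith [le_abs_self u]⟩
    exact ⟨φ, hmem φ, hφ⟩
  · refine ⟨_, ?_, ellipticF_arctan_sinh u⟩
    rw [ellipticDomain_one]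
    exact ⟨Real.neg_pi_div_two_lt_arctan _, Real.arctan_lt_pi_div_two _⟩

theorem jacobiAm_mem {m : ℝ} (hm : 0 ≤ m) (hm1 : m ≤ 1) (u : ℝ) :
    jacobiAm u m ∈ ellipticDomain m :=
  Function.invFunOn_mem (f := fun φ => ellipticF φ m) (exists_ellipticF_eq hm hm1 u)

theorem ellipticF_jacobiAm {m : ℝ} (hm : 0 ≤ m) (hm1 : m ≤ 1) (u : ℝ) :
    ellipticF (jacobiAm u m) m = u :=
  Function.invFunOn_eq (f := fun φ => ellipticF φ m) (exists_ellipticF_eq hm hm1 u)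

theorem jacobiAm_ellipticF {m φ : ℝ} (hm : 0 ≤ m) (hm1 : m ≤ 1) (hφ : φ ∈ ellipticDomain m) :
    jacobiAm (ellipticF φ m) m = φ :=
  (ellipticF_strictMonoOn hm hm1).injOn (jacobiAm_mem hm hm1 _) hφ (ellipticF_jacobiAm hm hm1 _)

theorem jacobiAm_zero {m : ℝ} (hm : 0 ≤ m) (hm1 : m ≤ 1) : jacobiAm 0 m = 0 := by
  simpa [ellipticF_zero] using jacobiAm_ellipticF hm hm1 (zero_mem_ellipticDomain m)

theorem jacobiAm_neg {m : ℝ} (hm : 0 ≤ m) (hm1 : m ≤ 1) (u : ℝ) :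
    jacobiAm (-u) m = -jacobiAm u m := by
  have := jacobiAm_ellipticF hm hm1 (neg_mem_ellipticDomain (jacobiAm_mem hm hm1 u))
  rwa [ellipticF_neg, ellipticF_jacobiAm hm hm1] at this

theorem jacobiAm_strictMono {m : ℝ} (hm : 0 ≤ m) (hm1 : m ≤ 1) :
    StrictMono fun u => jacobiAm u m := by
  intro u v huv
  by_contra! hc
  have := (ellipticF_strictMonoOn hm hm1).monotoneOn (jacobiAm_mem hm hm1 v)
    (jacobiAm_mem hm hm1 u) hc
  simp only [ellipticF_jacobiAm hm hm1] at this
  linarith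

theorem continuous_jacobiAm {m : ℝ} (hm : 0 ≤ m) (hm1 : m ≤ 1) :
    Continuous fun u => jacobiAm u m := by
  have key : ∀ u v, u ≤ v → |jacobiAm u m - jacobiAm v m| ≤ |u - v| := by
    intro u v huv
    have h1 := (jacobiAm_strictMono hm hm1).monotone huv
    have h2 := sub_le_ellipticF_sub hm hm1 (jacobiAm_mem hm hm1 u) (jacobiAm_mem hm hm1 v) h1
    rw [ellipticF_jacobiAm hm hm1, ellipticF_jacobiAm hm hm1] at h2
    rw [abs_sub_comm, abs_sub_comm u, abs_of_nonneg (by linarith), abs_of_nonneg (by linarith)]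
    exact h2
  refine (LipschitzWith.of_dist_le' (K := 1) fun u v => ?_).continuous
  rw [Real.dist_eq, Real.dist_eq, one_mul]
  rcases le_total u v with h | h
  · exact key u v h
  · rw [abs_sub_comm, abs_sub_comm u]; exact key v u h

theorem hasDerivAt_jacobiAm {m : ℝ} (hm : 0 ≤ m) (hm1 : m ≤ 1) (u : ℝ) :
    HasDerivAt (fun u => jacobiAm u m) (jacobiDn u m) u := by
  have hmem := jacobiAm_mem hm hm1 u
  have hpos : 0 < Real.sqrt (1 - m * Real.sin (jacobiAm u m) ^ 2) :=
    Real.sqrt_pos.2 (by linarith [mul_sin_sq_lt_one_of_mem hmem])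
  have := HasDerivAt.of_local_left_inverse (g := fun u => jacobiAm u m)
    (continuous_jacobiAm hm hm1).continuousAt (hasDerivAt_ellipticF hmem) (by positivity)
    (Filter.Eventually.of_forall fun y => ellipticF_jacobiAm hm hm1 y)
  simpa [jacobiDn] using this

theorem jacobiDn_pos {m : ℝ} (hm : 0 ≤ m) (hm1 : m ≤ 1) (u : ℝ) : 0 < jacobiDn u m :=
  Real.sqrt_pos.2 (by linarith [mul_sin_sq_lt_one_of_mem (jacobiAm_mem hm hm1 u)])

theorem jacobiDn_sq {m : ℝ} (hm : 0 ≤ m) (hm1 : m ≤ 1) (u : ℝ) :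
    jacobiDn u m ^ 2 = 1 - m * Real.sin (jacobiAm u m) ^ 2 :=
  Real.sq_sqrt (by linarith [mul_sin_sq_lt_one_of_mem (jacobiAm_mem hm hm1 u)])

theorem jacobiDn_zero {m : ℝ} (hm : 0 ≤ m) (hm1 : m ≤ 1) : jacobiDn 0 m = 1 := by
  simp [jacobiDn, jacobiAm_zero hm hm1]

theorem hasDerivAt_jacobiDn {m : ℝ} (hm : 0 ≤ m) (hm1 : m ≤ 1) (u : ℝ) :
    HasDerivAt (fun u => jacobiDn u m)
      (-(m * Real.sin (jacobiAm u m) * Real.cos (jacobiAm u m))) u := by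
  have hdn := jacobiDn_pos hm hm1 u
  have h1 := (((hasDerivAt_jacobiAm hm hm1 u).sin.pow 2).const_mul m).const_sub 1
  refine (h1.sqrt ?_).congr_deriv ?_
  · have := jacobiDn_sq hm hm1 u
    simp only [Pi.pow_apply]
    rw [← this]; positivity
  · simp only [Pi.pow_apply]
    change _ / (2 * jacobiDn u m) = _
    field_simp
    push_cast
    ring

end Elliptic

/-! ### Monotonicity and range of `k`. -/

namespace Ladder

/-- Absorbing `√(1+ν)` into the root leaves an integrand visibly decreasing in `ν`. -/
theorem k_eq_integral {ν : ℝ} (hν : 0 < ν) :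
    k ν = ∫ t in (0 : ℝ)..(Real.pi / 2), 1 / Real.sqrt (ν + Real.cos t ^ 2) := by
  rw [k, ellipticK, ellipticF, ← intervalIntegral.integral_div]
  refine intervalIntegral.integral_congr fun t _ => ?_
  rw [div_div, ← Real.sqrt_mul' _ (by linarith)]
  congr 2
  field_simp
  linarith [Real.sin_sq_add_cos_sq t]

theorem continuous_k_integrand {ν : ℝ} (hν : 0 < ν) :
    Continuous fun t => 1 / Real.sqrt (ν + Real.cos t ^ 2) := by
  refine Continuous.div continuous_const (by fun_prop) fun t => ?_
  positivity

theorem k_strictAntiOn : StrictAntiOn k (Ioi 0) := by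
  intro a ha b hb hab
  have ha' : 0 < a := ha
  have hb' : 0 < b := hb
  rw [k_eq_integral ha', k_eq_integral hb']
  have hlt : ∀ t, 1 / Real.sqrt (b + Real.cos t ^ 2) < 1 / Real.sqrt (a + Real.cos t ^ 2) := by
    intro t
    apply one_div_lt_one_div_of_lt (by positivity)
    exact Real.sqrt_lt_sqrt (by positivity) (by linarith)
  exact intervalIntegral.integral_lt_integral_of_continuousOn_of_le_of_exists_lt (by positivity)
    (continuous_k_integrand hb').continuousOn (continuous_k_integrand ha').continuousOn
    (fun t _ => (hlt t).le) ⟨0, ⟨le_rfl, by positivity⟩, hlt 0⟩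

theorem continuousOn_k : ContinuousOn k (Ioi 0) := by
  have h : ContinuousOn
      (fun ν => ∫ t in (0 : ℝ)..(Real.pi / 2), 1 / Real.sqrt (ν + Real.cos t ^ 2)) (Ioi 0) := by
    intro ν hν
    have hν' : 0 < ν := hν
    refine ContinuousAt.continuousWithinAt ?_
    refine intervalIntegral.continuousAt_of_dominated_interval
      (bound := fun _ => 1 / Real.sqrt (ν / 2)) ?_ ?_ (by simp) ?_
    · refine Filter.Eventually.of_forall fun x => Measurable.aestronglyMeasurable ?_
      fun_prop
    · filter_upwards [lt_mem_nhds (show ν / 2 < ν by linarith)] with x hx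
      refine Filter.Eventually.of_forall fun t _ => ?_
      rw [Real.norm_of_nonneg (by positivity)]
      apply one_div_le_one_div_of_le (by positivity)
      exact Real.sqrt_le_sqrt (by nlinarith [sq_nonneg (Real.cos t)])
    · refine Filter.Eventually.of_forall fun t _ => ?_
      refine ContinuousAt.div continuousAt_const (by fun_prop) ?_
      positivity
  exact h.congr fun ν hν => k_eq_integral hν

theorem k_le {ν : ℝ} (hν : 0 < ν) : k ν ≤ Real.pi / 2 / Real.sqrt ν := by
  rw [k_eq_integral hν]
  have h := intervalIntegral.integral_mono_on (μ := MeasureTheory.volume)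
    (a := 0) (b := Real.pi / 2) (by positivity)
    ((continuous_k_integrand hν).intervalIntegrable _ _)
    (g := fun _ => 1 / Real.sqrt ν) (by simp) (fun t _ => by
      apply one_div_le_one_div_of_le (by positivity)
      exact Real.sqrt_le_sqrt (by nlinarith [sq_nonneg (Real.cos t)]))
  simpa [div_eq_mul_inv] using h

/-- Gives the blow-up of `k` at `0`: from `cos t ≤ π/2 - t` follows `√(ν + cos² t) ≤ √ν + π/2 - t`,
whose reciprocal integrates to a logarithm. -/
theorem log_le_k {ν : ℝ} (hν : 0 < ν) :
    Real.log (Real.pi / 2) - Real.log (Real.sqrt ν) ≤ k ν := by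
  have hs := Real.sqrt_pos.2 hν
  have hpi := Real.pi_pos
  have hint : ∫ t in (0 : ℝ)..(Real.pi / 2), 1 / (Real.sqrt ν + Real.pi / 2 - t) =
      Real.log (Real.sqrt ν + Real.pi / 2) - Real.log (Real.sqrt ν) := by
    have hd : ∀ t ∈ uIcc 0 (Real.pi / 2),
        HasDerivAt (fun t => -Real.log (Real.sqrt ν + Real.pi / 2 - t))
          (1 / (Real.sqrt ν + Real.pi / 2 - t)) t := by
      intro t ht
      rw [uIcc_of_le (by positivity)] at ht
      have h0 : Real.sqrt ν + Real.pi / 2 - t ≠ 0 := by linarith [ht.2]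
      refine (((hasDerivAt_id t).const_sub (Real.sqrt ν + Real.pi / 2)).log h0).neg.congr_deriv ?_
      simp [neg_div]
    rw [intervalIntegral.integral_eq_sub_of_hasDerivAt hd]
    · simp; ring
    · refine ContinuousOn.intervalIntegrable fun t ht => ContinuousAt.continuousWithinAt ?_
      rw [uIcc_of_le (by positivity)] at ht
      exact ContinuousAt.div continuousAt_const (by fun_prop) (by linarith [ht.2])
  have hmono : ∫ t in (0 : ℝ)..(Real.pi / 2), 1 / (Real.sqrt ν + Real.pi / 2 - t) ≤ k ν := by
    rw [k_eq_integral hν]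
    refine intervalIntegral.integral_mono_on (by positivity) ?_
      ((continuous_k_integrand hν).intervalIntegrable _ _) fun t ht => ?_
    · refine ContinuousOn.intervalIntegrable fun t ht => ContinuousAt.continuousWithinAt ?_
      rw [uIcc_of_le (by positivity)] at ht
      exact ContinuousAt.div continuousAt_const (by fun_prop) (by linarith [ht.2])
    · apply one_div_le_one_div_of_le (by positivity)
      have hc0 : 0 ≤ Real.cos t := Real.cos_nonneg_of_mem_Icc ⟨by linarith [ht.1], ht.2⟩
      have hc : Real.cos t ≤ Real.pi / 2 - t := by
        rw [← Real.sin_pi_div_two_sub]; exact Real.sin_le (by linarith [ht.2])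
      rw [Real.sqrt_le_left (by linarith [ht.2])]
      nlinarith [Real.sq_sqrt hν.le]
  have := Real.log_le_log (show 0 < Real.pi / 2 by positivity)
    (show Real.pi / 2 ≤ Real.sqrt ν + Real.pi / 2 by linarith)
  linarith

theorem exists_k_eq {y : ℝ} (hy : 0 < y) : ∃ ν, 0 < ν ∧ k ν = y := by
  have hpi := Real.pi_pos
  obtain ⟨a, ha, hka⟩ : ∃ a, 0 < a ∧ y ≤ k a := by
    -- Chosen so that the lower bound of `log_le_k` equals `y` exactly.
    refine ⟨Real.exp (Real.log (Real.pi / 2) - y) ^ 2, by positivity, ?_⟩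
    have := log_le_k (ν := Real.exp (Real.log (Real.pi / 2) - y) ^ 2) (by positivity)
    rw [Real.sqrt_sq (Real.exp_pos _).le, Real.log_exp] at this
    linarith
  obtain ⟨b, hb, hkb⟩ : ∃ b, 0 < b ∧ k b ≤ y := by
    refine ⟨(Real.pi / 2 / y) ^ 2, by positivity, ?_⟩
    have := k_le (ν := (Real.pi / 2 / y) ^ 2) (by positivity)
    rwa [Real.sqrt_sq (by positivity), div_div_cancel₀ (by positivity)] at this
  obtain ⟨ν, hν, hk⟩ := isPreconnected_Ioi.intermediate_value (show b ∈ Ioi (0 : ℝ) from hb)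
    (show a ∈ Ioi (0 : ℝ) from ha) continuousOn_k ⟨hkb, hka⟩
  exact ⟨ν, hν, hk⟩

theorem exists_admissible_interval {ε L : ℝ} (hε : 0 < ε) (hL : 0 < L) :
    ∃ ν₁ ν₂ : ℝ, 0 < ν₁ ∧ ν₁ < ν₂ ∧
      k ν₁ = Real.sqrt ε * L ∧ k ν₂ = Real.sqrt ε * L / 2 ∧
      {ν : ℝ | Admissible ε L ν} = Ioo ν₁ ν₂ := by
  have hy : 0 < Real.sqrt ε * L := mul_pos (Real.sqrt_pos.2 hε) hL
  obtain ⟨ν₁, h₁, hk₁⟩ := exists_k_eq hy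
  obtain ⟨ν₂, h₂, hk₂⟩ := exists_k_eq (half_pos hy)
  refine ⟨ν₁, ν₂, h₁, ?_, hk₁, hk₂, ?_⟩
  · rw [← k_strictAntiOn.lt_iff_gt (show ν₂ ∈ Ioi (0 : ℝ) from h₂) h₁]
    linarith
  · ext ν
    simp only [mem_ofPred_eq, Admissible, mem_Ioo]
    constructor
    · rintro ⟨h, ha, hb⟩
      rw [← hk₂, k_strictAntiOn.lt_iff_gt (show ν₂ ∈ Ioi (0 : ℝ) from h₂) h] at ha
      rw [← hk₁, k_strictAntiOn.lt_iff_gt (show ν ∈ Ioi (0 : ℝ) from h) h₁] at hb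
      exact ⟨hb, ha⟩
    · rintro ⟨ha, hb⟩
      have h : 0 < ν := h₁.trans ha
      refine ⟨h, ?_, ?_⟩
      · rw [← hk₂]; exact k_strictAntiOn h h₂ hb
      · rw [← hk₁]; exact k_strictAntiOn h₁ h ha

end Ladder

/-! ### Global pendulum solutions and their explicit Jacobi form. -/

namespace Ladder

/-- `Φ` solves `Φ'' + 2 ε sin 2Φ = 0` on the whole line, with derivative `P`. -/
structure IsPendulum (ε : ℝ) (Φ P : ℝ → ℝ) : Prop where
  hasDerivAt : ∀ x, HasDerivAt Φ (P x) x
  hasDerivAt' : ∀ x, HasDerivAt P (-(2 * ε * Real.sin (2 * Φ x))) x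

/-- The vector field of the pendulum equation in the phase plane. -/
def phaseField (ε : ℝ) (p : ℝ × ℝ) : ℝ × ℝ := (p.2, -(2 * ε * Real.sin (2 * p.1)))

theorem lipschitzWith_phaseField {ε : ℝ} (hε : 0 < ε) :
    LipschitzWith (Real.toNNReal (1 + 4 * ε)) (phaseField ε) := by
  refine LipschitzWith.of_dist_le' fun p q => ?_
  rw [Prod.dist_eq]
  have h1 : dist p.1 q.1 ≤ dist p q := le_max_left _ _
  have h2 : dist p.2 q.2 ≤ dist p q := le_max_right _ _
  have h0 : 0 ≤ dist p q := dist_nonneg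
  refine max_le ?_ ?_
  · simp only [phaseField]
    nlinarith
  · simp only [phaseField]
    rw [Real.dist_eq] at h1 ⊢
    have h3 := Real.abs_sin_sub_sin_le (2 * p.1) (2 * q.1)
    rw [← mul_sub, abs_mul, abs_two] at h3
    have h4 : -(2 * ε * Real.sin (2 * p.1)) - -(2 * ε * Real.sin (2 * q.1)) =
        -(2 * ε) * (Real.sin (2 * p.1) - Real.sin (2 * q.1)) := by ring
    rw [h4, abs_mul, abs_neg, abs_of_pos (by positivity : 0 < 2 * ε)]
    nlinarith

namespace IsPendulum

variable {ε : ℝ} {Φ P : ℝ → ℝ}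

theorem continuous (h : IsPendulum ε Φ P) : Continuous Φ :=
  continuous_iff_continuousAt.2 fun x => (h.hasDerivAt x).continuousAt

theorem continuous' (h : IsPendulum ε Φ P) : Continuous P :=
  continuous_iff_continuousAt.2 fun x => (h.hasDerivAt' x).continuousAt

theorem comp_add (h : IsPendulum ε Φ P) (c : ℝ) :
    IsPendulum ε (fun x => Φ (x + c)) (fun x => P (x + c)) :=
  ⟨fun x => (h.hasDerivAt (x + c)).comp_add_const x c,
    fun x => (h.hasDerivAt' (x + c)).comp_add_const x c⟩

theorem sub_pi (h : IsPendulum ε Φ P) : IsPendulum ε (fun x => Φ x - Real.pi) P := by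
  refine ⟨fun x => (h.hasDerivAt x).sub_const _, fun x => ?_⟩
  have h1 : Real.sin (2 * (Φ x - Real.pi)) = Real.sin (2 * Φ x) := by
    rw [mul_sub, Real.sin_sub_two_pi]
  rw [h1]
  exact h.hasDerivAt' x

theorem hasDerivAt_prod (h : IsPendulum ε Φ P) (x : ℝ) :
    HasDerivAt (fun x => (Φ x, P x)) (phaseField ε (Φ x, P x)) x :=
  (h.hasDerivAt x).prodMk (h.hasDerivAt' x)

theorem unique (hε : 0 < ε) (h : IsPendulum ε Φ P) {Ψ Q : ℝ → ℝ} (h' : IsPendulum ε Ψ Q)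
    {x₀ : ℝ} (h0 : Φ x₀ = Ψ x₀) (h1 : P x₀ = Q x₀) : Φ = Ψ ∧ P = Q := by
  have := ODE_solution_unique_univ (v := fun _ => phaseField ε) (s := fun _ => univ) (t₀ := x₀)
    (fun _ => (lipschitzWith_phaseField hε).lipschitzOnWith)
    (fun t => ⟨h.hasDerivAt_prod t, trivial⟩) (fun t => ⟨h'.hasDerivAt_prod t, trivial⟩)
    (by rw [h0, h1])
  exact ⟨funext fun x => congrArg Prod.fst (congrFun this x),
    funext fun x => congrArg Prod.snd (congrFun this x)⟩

end IsPendulum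

section Explicit

variable {ε ν : ℝ}

theorem isPendulum_jacobiAm (hε : 0 < ε) (hν : 0 ≤ ν) :
    IsPendulum ε (fun x => jacobiAm (2 * Real.sqrt ε * Real.sqrt (1 + ν) * x) (1 / (1 + ν)))
      (fun x => 2 * Real.sqrt ε * Real.sqrt (1 + ν) *
        jacobiDn (2 * Real.sqrt ε * Real.sqrt (1 + ν) * x) (1 / (1 + ν))) := by
  have hm : 0 ≤ 1 / (1 + ν) := by positivity
  have hm1 : 1 / (1 + ν) ≤ 1 := by rw [div_le_one (by linarith)]; linarith
  set c := 2 * Real.sqrt ε * Real.sqrt (1 + ν) with hc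
  have hc2 : c ^ 2 = 4 * ε * (1 + ν) := by
    rw [hc, mul_pow, mul_pow, Real.sq_sqrt hε.le, Real.sq_sqrt (by linarith)]; ring
  refine ⟨fun x => ?_, fun x => ?_⟩
  · refine ((hasDerivAt_jacobiAm hm hm1 (c * x)).comp x
      ((hasDerivAt_id x).const_mul c)).congr_deriv ?_
    simp; ring
  · refine (((hasDerivAt_jacobiDn hm hm1 (c * x)).comp x
      ((hasDerivAt_id x).const_mul c)).const_mul c).congr_deriv ?_
    rw [Real.sin_two_mul]
    have h1 : c ^ 2 * (1 / (1 + ν)) = 4 * ε := by rw [hc2]; field_simp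
    linear_combination (-(Real.sin (jacobiAm (c * x) (1 / (1 + ν))) *
      Real.cos (jacobiAm (c * x) (1 / (1 + ν))))) * h1

/-- The oscillating regime: `sin Φ = √(1+ν) sn` with modulus parameter `1 + ν < 1`, hence `cos Φ =
dn`. This is the reciprocal-parameter identity behind `jacobiCn` for `m > 1`. -/
theorem isPendulum_arcsin_jacobiAm (hε : 0 < ε) (hν : -1 < ν) (hν0 : ν < 0) :
    IsPendulum ε
      (fun x => Real.arcsin (Real.sqrt (1 + ν) *
        Real.sin (jacobiAm (2 * Real.sqrt ε * x) (1 + ν))))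
      (fun x => 2 * Real.sqrt ε * Real.sqrt (1 + ν) *
        Real.cos (jacobiAm (2 * Real.sqrt ε * x) (1 + ν))) := by
  have hm : 0 ≤ 1 + ν := by linarith
  have hm1 : 1 + ν ≤ 1 := by linarith
  set c := 2 * Real.sqrt ε with hc
  have hc2 : c ^ 2 = 4 * ε := by rw [hc, mul_pow, Real.sq_sqrt hε.le]; ring
  have hs2 := Real.sq_sqrt hm
  set r := Real.sqrt (1 + ν)
  have hdn : ∀ x, 1 - (r * Real.sin (jacobiAm (c * x) (1 + ν))) ^ 2 =
      jacobiDn (c * x) (1 + ν) ^ 2 := fun x => by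
    rw [jacobiDn_sq hm hm1, mul_pow, hs2]
  have hsq : ∀ x, Real.sqrt (1 - (r * Real.sin (jacobiAm (c * x) (1 + ν))) ^ 2) =
      jacobiDn (c * x) (1 + ν) := fun x => by
    rw [hdn, Real.sqrt_sq (jacobiDn_pos hm hm1 _).le]
  have hlt : ∀ x, |r * Real.sin (jacobiAm (c * x) (1 + ν))| < 1 := fun x => by
    rw [← sq_lt_one_iff_abs_lt_one]
    have := pow_pos (jacobiDn_pos hm hm1 (c * x)) 2
    linarith [hdn x]
  have ham : ∀ x, HasDerivAt (fun x => jacobiAm (c * x) (1 + ν)) (jacobiDn (c * x) (1 + ν) * c) x :=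
    fun x => by
      refine ((hasDerivAt_jacobiAm hm hm1 (c * x)).comp x
        ((hasDerivAt_id x).const_mul c)).congr_deriv ?_
      simp
  refine ⟨fun x => ?_, fun x => ?_⟩
  · have h1 := (abs_lt.1 (hlt x)).1
    have h2 := (abs_lt.1 (hlt x)).2
    refine ((Real.hasDerivAt_arcsin h1.ne' h2.ne).comp x ((ham x).sin.const_mul r)).congr_deriv ?_
    rw [hsq]
    have := jacobiDn_pos hm hm1 (c * x)
    field_simp
  · refine ((ham x).cos.const_mul (c * r)).congr_deriv ?_
    rw [Real.sin_two_mul, Real.cos_arcsin, hsq,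
      Real.sin_arcsin (abs_lt.1 (hlt x)).1.le (abs_lt.1 (hlt x)).2.le]
    linear_combination (-(r * Real.sin (jacobiAm (c * x) (1 + ν)) *
      jacobiDn (c * x) (1 + ν))) * hc2

/-- Uniform interface to both regimes. Only the case `ν > 0` needs the inversion formula, since only
there can the amplitude pass `π/2`. -/
theorem exists_isPendulum (hε : 0 < ε) (hν : -1 < ν) :
    ∃ Φ P : ℝ → ℝ, IsPendulum ε Φ P ∧ Φ 0 = 0 ∧ P 0 = 2 * Real.sqrt ε * Real.sqrt (1 + ν) ∧
      (∀ x, Real.cos (Φ x) ^ 2 =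
        jacobiCn (2 * Real.sqrt ε * Real.sqrt (1 + ν) * x) (1 / (1 + ν)) ^ 2) ∧
      (0 < ν → (∀ x, Φ (-x) = -Φ x) ∧ (∀ x, 0 < P x) ∧
        ∀ x, ellipticF (Φ x) (1 / (1 + ν)) = 2 * Real.sqrt ε * Real.sqrt (1 + ν) * x) := by
  rcases le_or_gt 0 ν with h0 | h0
  · have hm : 0 ≤ 1 / (1 + ν) := by positivity
    have hm1 : 1 / (1 + ν) ≤ 1 := by rw [div_le_one (by linarith)]; linarith
    refine ⟨_, _, isPendulum_jacobiAm hε h0, ?_, ?_, fun x => ?_, fun hpos =>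
      ⟨fun x => ?_, fun x => ?_, fun x => ?_⟩⟩
    · simp only [mul_zero]
      exact jacobiAm_zero hm hm1
    · simp only [mul_zero]
      rw [jacobiDn_zero hm hm1, mul_one]
    · rw [jacobiCn, if_pos hm1]
    · simp only [mul_neg]
      exact jacobiAm_neg hm hm1 _
    · have := jacobiDn_pos hm hm1 (2 * Real.sqrt ε * Real.sqrt (1 + ν) * x)
      positivity
    · exact ellipticF_jacobiAm hm hm1 _
  · have hm : 0 ≤ 1 + ν := by linarith
    have hm1 : 1 + ν ≤ 1 := by linarith
    refine ⟨_, _, isPendulum_arcsin_jacobiAm hε hν h0, ?_, ?_, fun x => ?_, fun hpos => ?_⟩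
    · simp [jacobiAm_zero hm hm1]
    · simp [jacobiAm_zero hm hm1]
    · have hn : ¬ 1 / (1 + ν) ≤ 1 := by
        rw [div_le_one (by linarith)]; linarith
      have hr : 0 < Real.sqrt (1 + ν) := Real.sqrt_pos.2 (by linarith)
      rw [jacobiCn, if_neg hn, one_div_one_div, Real.cos_arcsin]
      have harg : Real.sqrt (1 / (1 + ν)) * (2 * Real.sqrt ε * Real.sqrt (1 + ν) * x) =
          2 * Real.sqrt ε * x := by
        rw [Real.sqrt_div zero_le_one, Real.sqrt_one]
        field_simp
      rw [harg, mul_pow, Real.sq_sqrt hm]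
      rfl
    · linarith

end Explicit

end Ladder

/-! ### Reflection symmetry, the first integral, and the shape of a perversion. -/

namespace Ladder

variable {ε L U₀ ν : ℝ} {θ : ℝ → ℝ}

theorem slope_eq_of_hasDerivAt {d R : ℝ} (hL : 0 < L) (h : HasDerivAt θ d R) (hR : R ∈ Icc 0 L) :
    slope L θ R = d :=
  h.hasDerivWithinAt.derivWithin (uniqueDiffOn_Icc hL R hR)

theorem slope_congr {η : ℝ → ℝ} {R : ℝ} (h : ∀ R ∈ Icc 0 L, θ R = η R) (hR : R ∈ Icc 0 L) :
    slope L θ R = slope L η R :=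
  derivWithin_congr h (h R hR)

theorem energy_congr {η : ℝ → ℝ} (hL : 0 < L) (h : ∀ R ∈ Icc 0 L, θ R = η R) :
    energy ε L U₀ θ = energy ε L U₀ η := by
  refine intervalIntegral.integral_congr fun R hR => ?_
  rw [uIcc_of_le hL.le] at hR
  simp only [slope_congr h hR, h R hR]

theorem slope_neg (L : ℝ) (θ : ℝ → ℝ) (R : ℝ) : slope L (fun R => -θ R) R = -slope L θ R :=
  derivWithin.fun_neg

theorem V_neg (ε x : ℝ) : V ε (-x) = V ε x := by simp [V]

theorem energy_neg (ε L U₀ : ℝ) (θ : ℝ → ℝ) :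
    energy ε L (-U₀) (fun R => -θ R) = energy ε L U₀ θ := by
  refine intervalIntegral.integral_congr fun R _ => ?_
  simp only [slope_neg, V_neg]
  ring

theorem IsSolution.neg (h : IsSolution ε L θ) : IsSolution ε L (fun R => -θ R) := by
  refine ⟨h.1.neg, fun R hR => ?_⟩
  have h1 : slope L (fun R => -θ R) = fun R => -slope L θ R := funext (slope_neg L θ)
  rw [h1]
  refine (h.2 R hR).neg.congr_deriv ?_
  simp

theorem IsEquilibrium.neg (h : IsEquilibrium ε L U₀ θ) :
    IsEquilibrium ε L (-U₀) (fun R => -θ R) := by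
  refine ⟨h.1.neg, ?_, ?_⟩ <;> rw [slope_neg]
  · rw [h.2.1]
  · rw [h.2.2]

theorem IsLocalMinimizer.neg (h : IsLocalMinimizer ε L U₀ θ) :
    IsLocalMinimizer ε L (-U₀) (fun R => -θ R) := by
  obtain ⟨δ, hδ, h⟩ := h
  refine ⟨δ, hδ, fun η hη hclose => ?_⟩
  have := h (fun R => -η R) hη.neg fun R hR => by
    obtain ⟨h1, h2⟩ := hclose R hR
    rw [slope_neg] at h2 ⊢
    constructor
    · rw [← abs_neg]; convert h1 using 2; ring
    · rw [← abs_neg]; convert h2 using 2; ring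
  rw [energy_neg]
  have h2 := energy_neg ε L (-U₀) η
  rw [neg_neg] at h2
  rwa [← h2]

theorem isStable_neg_iff :
    IsStable ε L (-U₀) (fun R => -θ R) ↔ IsStable ε L U₀ θ :=
  ⟨fun h => by simpa [IsStable] using And.intro h.1.neg h.2.neg, fun h => ⟨h.1.neg, h.2.neg⟩⟩

theorem IsPerversion.neg (h : IsPerversion ε L θ) : IsPerversion ε L (fun R => -θ R) := by
  refine ⟨h.1.neg, fun R hR => congrArg Neg.neg (h.2.1 R hR), fun R hR => ?_⟩
  rw [slope_neg]
  exact neg_ne_zero.2 (h.2.2 R hR)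

theorem HasParameter.neg (h : HasParameter ε L θ ν) : HasParameter ε L (fun R => -θ R) ν := by
  intro R hR
  rw [h R hR, pseudoEnergy, pseudoEnergy, slope_neg, V_neg, neg_sq]

theorem noFlangeContact_neg_iff : NoFlangeContact L (fun R => -θ R) ↔ NoFlangeContact L θ := by
  simp [NoFlangeContact]

theorem hasDerivAt_V (ε x : ℝ) : HasDerivAt (V ε) (2 * ε * Real.sin (2 * x)) x := by
  have h := (((hasDerivAt_id x).const_mul 2).cos).const_mul (-ε)
  refine h.congr_deriv ?_
  simp; ring

theorem deriv_V (ε : ℝ) : deriv (V ε) = fun x => 2 * ε * Real.sin (2 * x) :=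
  funext fun x => (hasDerivAt_V ε x).deriv

theorem deriv_deriv_V (ε x : ℝ) : deriv (deriv (V ε)) x = 4 * ε * Real.cos (2 * x) := by
  rw [deriv_V]
  have h := (((hasDerivAt_id x).const_mul 2).sin).const_mul (2 * ε)
  refine h.deriv.trans ?_
  simp; ring

theorem mem_GammaMin_iff (hε : 0 < ε) {p : ℝ × ℝ} : p ∈ GammaMin ε ↔ Real.sin p.1 = 0 := by
  rw [GammaMin, mem_ofPred_eq, deriv_deriv_V, (hasDerivAt_V ε p.1).deriv, Real.sin_two_mul,
    Real.cos_two_mul']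
  constructor
  · rintro ⟨h1, h2⟩
    by_contra h
    have hc : Real.cos p.1 = 0 := by simpa [hε.ne', h] using h1
    rw [hc] at h2
    nlinarith [sq_nonneg (Real.sin p.1)]
  · intro h
    have := Real.sin_sq_add_cos_sq p.1
    rw [h] at this ⊢
    refine ⟨by simp, ?_⟩
    nlinarith

theorem mem_GammaMax_iff (hε : 0 < ε) {p : ℝ × ℝ} : p ∈ GammaMax ε ↔ Real.cos p.1 = 0 := by
  rw [GammaMax, mem_ofPred_eq, deriv_deriv_V, (hasDerivAt_V ε p.1).deriv, Real.sin_two_mul,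
    Real.cos_two_mul']
  constructor
  · rintro ⟨h1, h2⟩
    by_contra h
    have hc : Real.sin p.1 = 0 := by simpa [hε.ne', h] using h1
    rw [hc] at h2
    nlinarith [sq_nonneg (Real.cos p.1)]
  · intro h
    have := Real.sin_sq_add_cos_sq p.1
    rw [h] at this ⊢
    refine ⟨by simp, ?_⟩
    nlinarith

theorem stabilityIndex_eq (hε : 0 < ε) : stabilityIndex ε L θ =
    ({R ∈ Icc 0 L | Real.sin (θ R) = 0}.ncard : ℤ) -
    ({R ∈ Icc 0 L | Real.cos (θ R) = 0}.ncard : ℤ) := by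
  simp only [stabilityIndex, mem_GammaMin_iff hε, mem_GammaMax_iff hε]

theorem stabilityIndex_neg (hε : 0 < ε) :
    stabilityIndex ε L (fun R => -θ R) = stabilityIndex ε L θ := by
  simp [stabilityIndex_eq hε]

section Solution

theorem IsSolution.hasDerivWithinAt (h : IsSolution ε L θ) {R : ℝ} (hR : R ∈ Icc 0 L) :
    HasDerivWithinAt θ (slope L θ R) (Icc 0 L) R :=
  (h.1 R hR).hasDerivWithinAt

theorem IsSolution.hasDerivAt (h : IsSolution ε L θ) {R : ℝ} (hR : R ∈ Ioo 0 L) :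
    HasDerivAt θ (slope L θ R) R :=
  (h.hasDerivWithinAt (Ioo_subset_Icc_self hR)).hasDerivAt (Icc_mem_nhds hR.1 hR.2)

theorem IsSolution.continuousOn (h : IsSolution ε L θ) : ContinuousOn θ (Icc 0 L) :=
  h.1.continuousOn

theorem IsSolution.continuousOn_slope (h : IsSolution ε L θ) :
    ContinuousOn (slope L θ) (Icc 0 L) :=
  fun R hR => (h.2 R hR).continuousWithinAt

/-- Replaces a solution with one-sided derivatives at the ends by a pendulum solution on the whole
line, which can be differentiated and translated freely. -/
theorem IsSolution.eqOn_of_isPendulum (hε : 0 < ε) (h : IsSolution ε L θ) {Φ P : ℝ → ℝ}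
    (hΦ : IsPendulum ε Φ P) {R₀ : ℝ} (hR₀ : R₀ ∈ Ioo 0 L) (h0 : θ R₀ = Φ R₀)
    (h1 : slope L θ R₀ = P R₀) : ∀ R ∈ Icc 0 L, θ R = Φ R ∧ slope L θ R = P R := by
  have := ODE_solution_unique_of_mem_Icc (v := fun _ => phaseField ε) (s := fun _ => univ)
    (f := fun R => (θ R, slope L θ R)) (g := fun R => (Φ R, P R))
    (fun _ _ => (lipschitzWith_phaseField hε).lipschitzOnWith) hR₀
    (h.continuousOn.prodMk h.continuousOn_slope)
    (fun R hR => (h.hasDerivAt hR).prodMk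
      ((h.2 R (Ioo_subset_Icc_self hR)).hasDerivAt (Icc_mem_nhds hR.1 hR.2)))
    (fun _ _ => trivial)
    (hΦ.continuous.prodMk hΦ.continuous').continuousOn
    (fun R _ => hΦ.hasDerivAt_prod R) (fun _ _ => trivial) (by rw [h0, h1])
  intro R hR
  have h2 := this hR
  exact ⟨congrArg Prod.fst h2, congrArg Prod.snd h2⟩

theorem IsSolution.exists_hasParameter (h : IsSolution ε L θ) : ∃ ν, HasParameter ε L θ ν := by
  have hd : ∀ R ∈ Icc 0 L, HasDerivWithinAt (pseudoEnergy ε L θ) 0 (Icc 0 L) R := by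
    intro R hR
    have h1 := ((h.2 R hR).pow 2).div_const 2
    have h2 := (hasDerivAt_V ε (θ R)).comp_hasDerivWithinAt R (h.hasDerivWithinAt hR)
    refine (h1.add h2).congr_deriv ?_
    push_cast
    ring
  refine ⟨(pseudoEnergy ε L θ 0 / ε - 1) / 2, fun R hR => ?_⟩
  rw [constant_of_has_deriv_right_zero (fun x hx => (hd x hx).continuousWithinAt)
    (fun x hx => (hd x (Ico_subset_Icc_self hx)).mono_of_mem_nhdsWithin
      (Icc_mem_nhdsGE_of_mem hx)) R hR]

theorem HasParameter.slope_sq (hε : 0 < ε) (h : HasParameter ε L θ ν) {R : ℝ}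
    (hR : R ∈ Icc 0 L) : slope L θ R ^ 2 = 4 * ε * (ν + Real.cos (θ R) ^ 2) := by
  have h1 := h R hR
  rw [pseudoEnergy, V, Real.cos_two_mul] at h1
  field_simp at h1
  linarith

end Solution

namespace IsPerversion

theorem apply_half (hL : 0 < L) (h : IsPerversion ε L θ) : θ (L / 2) = 0 := by
  have := h.2.1 (L / 2) ⟨by linarith, by linarith⟩
  rw [sub_half] at this
  linarith

theorem apply_zero (hL : 0 < L) (h : IsPerversion ε L θ) : θ 0 = -θ L := by
  simpa using h.2.1 L ⟨hL.le, le_rfl⟩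

theorem slope_half_sq (hε : 0 < ε) (hL : 0 < L) (h : IsPerversion ε L θ)
    (hν : HasParameter ε L θ ν) : slope L θ (L / 2) ^ 2 = 4 * ε * (1 + ν) := by
  rw [hν.slope_sq hε ⟨by linarith, by linarith⟩, h.apply_half hL]
  rw [Real.cos_zero]; ring

theorem neg_one_lt (hε : 0 < ε) (hL : 0 < L) (h : IsPerversion ε L θ)
    (hν : HasParameter ε L θ ν) : -1 < ν := by
  have h1 := h.slope_half_sq hε hL hν
  have h2 := h.2.2 (L / 2) ⟨by linarith, by linarith⟩
  have h3 : 0 < slope L θ (L / 2) ^ 2 := by positivity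
  rw [h1] at h3
  have := (mul_pos_iff_of_pos_left (by positivity : 0 < 4 * ε)).1 h3
  linarith

theorem slope_pos (hL : 0 < L) (h : IsPerversion ε L θ) (hp : 0 < slope L θ (L / 2)) {R : ℝ}
    (hR : R ∈ Ioo 0 L) : 0 < slope L θ R := by
  by_contra! hc
  obtain ⟨x, hx, hx0⟩ := isPreconnected_Ioo.intermediate_value hR
    (show L / 2 ∈ Ioo 0 L from ⟨by linarith, by linarith⟩)
    (h.1.continuousOn_slope.mono Ioo_subset_Icc_self) ⟨hc, hp.le⟩
  exact h.2.2 x hx hx0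

/-- Only the weak sign survives at the end points, where the slope of a perversion may vanish; it
follows from continuity. -/
theorem slope_nonneg (hL : 0 < L) (h : IsPerversion ε L θ) (hp : 0 < slope L θ (L / 2)) {R : ℝ}
    (hR : R ∈ Icc 0 L) : 0 ≤ slope L θ R := by
  have hcl : closure (Ioo 0 L) = Icc 0 L := closure_Ioo hL.ne
  have h2 : MapsTo (slope L θ) (closure (Ioo 0 L)) (closure (Ici 0)) :=
    MapsTo.closure_of_continuousOn (fun x hx => (h.slope_pos hL hp hx).le)
      (by rw [hcl]; exact h.1.continuousOn_slope)
  rw [hcl, closure_Ici] at h2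
  exact h2 hR

theorem slope_zero_eq (hε : 0 < ε) (hL : 0 < L) (h : IsPerversion ε L θ)
    (hν : HasParameter ε L θ ν) (hp : 0 < slope L θ (L / 2)) : slope L θ 0 = slope L θ L := by
  have h0 : (0 : ℝ) ∈ Icc 0 L := ⟨le_rfl, hL.le⟩
  have h1 : L ∈ Icc 0 L := ⟨hL.le, le_rfl⟩
  rw [← sq_eq_sq₀ (h.slope_nonneg hL hp h0) (h.slope_nonneg hL hp h1), hν.slope_sq hε h0,
    hν.slope_sq hε h1, h.apply_zero hL, Real.cos_neg]

theorem strictMonoOn (hL : 0 < L) (h : IsPerversion ε L θ) (hp : 0 < slope L θ (L / 2)) :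
    StrictMonoOn θ (Icc 0 L) := by
  refine strictMonoOn_of_deriv_pos (convex_Icc 0 L) h.1.continuousOn fun x hx => ?_
  rw [interior_Icc] at hx
  rw [(h.1.hasDerivAt hx).deriv]
  exact h.slope_pos hL hp hx

theorem apply_pos (hL : 0 < L) (h : IsPerversion ε L θ) (hp : 0 < slope L θ (L / 2)) :
    0 < θ L := by
  rw [← h.apply_half hL]
  exact h.strictMonoOn hL hp ⟨by linarith, by linarith⟩ ⟨hL.le, le_rfl⟩ (by linarith)

theorem abs_apply_le (hL : 0 < L) (h : IsPerversion ε L θ) (hp : 0 < slope L θ (L / 2)) {R : ℝ}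
    (hR : R ∈ Icc 0 L) : |θ R| ≤ θ L := by
  have hm := (h.strictMonoOn hL hp).monotoneOn
  have h1 := hm hR ⟨hL.le, le_rfl⟩ hR.2
  have h2 := hm ⟨le_rfl, hL.le⟩ hR hR.1
  rw [h.apply_zero hL] at h2
  exact abs_le.2 ⟨h2, h1⟩

theorem noFlangeContact_iff (hL : 0 < L) (h : IsPerversion ε L θ)
    (hp : 0 < slope L θ (L / 2)) : NoFlangeContact L θ ↔ θ L < Real.pi := by
  constructor
  · intro hn
    exact lt_of_abs_lt (hn L ⟨hL.le, le_rfl⟩)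
  · intro hn R hR
    exact (h.abs_apply_le hL hp hR).trans_lt hn

/-- With nonpositive parameter the amplitude does not exceed `π / 2`. -/
theorem apply_le_of_nonpos (hε : 0 < ε) (hL : 0 < L) (h : IsPerversion ε L θ)
    (hν : HasParameter ε L θ ν) (hp : 0 < slope L θ (L / 2)) (hν0 : ν ≤ 0) :
    θ L ≤ Real.pi / 2 := by
  by_contra! hc
  obtain ⟨x, hx, hx2⟩ := intermediate_value_Icc (show L / 2 ≤ L by linarith)
    (h.1.continuousOn.mono (Icc_subset_Icc (by linarith) le_rfl))
    (show Real.pi / 2 ∈ Icc (θ (L / 2)) (θ L) from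
      ⟨by rw [h.apply_half hL]; positivity, hc.le⟩)
  have hxL : x < L := by
    refine lt_of_le_of_ne hx.2 ?_
    rintro rfl
    exact hc.ne' hx2
  have hxI : x ∈ Ioo 0 L := ⟨by linarith [hx.1], hxL⟩
  have h1 := hν.slope_sq hε (Ioo_subset_Icc_self hxI)
  rw [hx2, Real.cos_pi_div_two] at h1
  have h2 := pow_pos (h.slope_pos hL hp hxI) 2
  rw [h1] at h2
  nlinarith

theorem exists_isPendulum (hε : 0 < ε) (hL : 0 < L) (h : IsPerversion ε L θ)
    (hν : HasParameter ε L θ ν) (hp : 0 < slope L θ (L / 2)) :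
    ∃ Φ P : ℝ → ℝ, IsPendulum ε Φ P ∧ (∀ R ∈ Icc 0 L, θ R = Φ R ∧ slope L θ R = P R) ∧
      Real.cos (θ L) ^ 2 =
        jacobiCn (Real.sqrt ε * L * Real.sqrt (1 + ν)) (1 / (1 + ν)) ^ 2 ∧
      (0 < ν → ellipticF (θ L) (1 / (1 + ν)) = Real.sqrt ε * L * Real.sqrt (1 + ν)) := by
  have hν1 := h.neg_one_lt hε hL hν
  obtain ⟨Φ, P, hΦ, h0, h1, hcn, hF⟩ := Ladder.exists_isPendulum hε hν1
  have hshift := hΦ.comp_add (-(L / 2))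
  have hs : slope L θ (L / 2) = 2 * Real.sqrt ε * Real.sqrt (1 + ν) := by
    rw [← sq_eq_sq₀ hp.le (by positivity), h.slope_half_sq hε hL hν, mul_pow, mul_pow,
      Real.sq_sqrt hε.le, Real.sq_sqrt (by linarith)]
    ring
  have heq := h.1.eqOn_of_isPendulum hε hshift (R₀ := L / 2) ⟨by linarith, by linarith⟩
    (by simp [h.apply_half hL, h0]) (by simp [hs, h1])
  have hLΦ : θ L = Φ (L / 2) := by
    rw [(heq L ⟨hL.le, le_rfl⟩).1]
    congr 1; ring
  have harg : 2 * Real.sqrt ε * Real.sqrt (1 + ν) * (L / 2) =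
      Real.sqrt ε * L * Real.sqrt (1 + ν) := by ring
  refine ⟨_, _, hshift, heq, ?_, fun hpos => ?_⟩
  · rw [hLΦ, hcn, harg]
  · rw [hLΦ, (hF hpos).2.2, harg]

end IsPerversion

end Ladder

/-! ### Expansion of the energy to second order. -/

namespace Ladder

variable {ε L U₀ ν : ℝ} {θ Φ P : ℝ → ℝ}

theorem abs_cos_add_taylor_le (x : ℝ) {y : ℝ} (hy : |y| ≤ 1) :
    |Real.cos (x + y) - (Real.cos x - y * Real.sin x - y ^ 2 / 2 * Real.cos x)| ≤ |y| ^ 3 := by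
  have h1 := abs_le.1 (Real.cos_bound hy)
  have h2 := abs_le.1 (Real.sin_bound hy)
  have h0 := abs_nonneg y
  have h4 : |y| ^ 4 ≤ |y| ^ 3 := pow_le_pow_of_le_one h0 hy (by norm_num)
  have h6 : |y| ^ 5 ≤ |y| ^ 3 := pow_le_pow_of_le_one h0 hy (by norm_num)
  have h3 : |y ^ 3| = |y| ^ 3 := abs_pow y 3
  have h5 := abs_le.1 h3.le
  have hA : |Real.cos y - 1 + y ^ 2 / 2| ≤ 5 / 96 * |y| ^ 3 := by
    rw [abs_le]; constructor <;> linarith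
  have hB : |Real.sin y - y| ≤ (5 / 96 + 1 / 6) * |y| ^ 3 := by
    rw [abs_le]; constructor <;> linarith
  have hcx := Real.abs_cos_le_one x
  have hsx := Real.abs_sin_le_one x
  have key : Real.cos (x + y) - (Real.cos x - y * Real.sin x - y ^ 2 / 2 * Real.cos x) =
      Real.cos x * (Real.cos y - 1 + y ^ 2 / 2) - Real.sin x * (Real.sin y - y) := by
    rw [Real.cos_add]; ring
  rw [key]
  refine (abs_sub _ _).trans ?_
  rw [abs_mul, abs_mul]
  have e1 := mul_le_mul hcx hA (abs_nonneg _) zero_le_one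
  have e2 := mul_le_mul hsx hB (abs_nonneg _) zero_le_one
  have : 0 ≤ |y| ^ 3 := by positivity
  linarith

/-- Second order expansion of the energy density, with a cubic remainder. -/
theorem abs_energy_density_sub_le (hε : 0 < ε) (φ p u q : ℝ) {h : ℝ} (hh : |h| ≤ 1 / 2) :
    |((p + q - u) ^ 2 / 2 - V ε (φ + h)) - ((p - u) ^ 2 / 2 - V ε φ) -
      (q * (p - u) - 2 * ε * Real.sin (2 * φ) * h +
        (q ^ 2 - 4 * ε * Real.cos (2 * φ) * h ^ 2) / 2)| ≤ 8 * ε * |h| ^ 3 := by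
  have h2 : |2 * h| = 2 * |h| := by rw [abs_mul, abs_two]
  have ht := abs_cos_add_taylor_le (2 * φ) (y := 2 * h) (by rw [h2]; linarith)
  have key : ((p + q - u) ^ 2 / 2 - V ε (φ + h)) - ((p - u) ^ 2 / 2 - V ε φ) -
      (q * (p - u) - 2 * ε * Real.sin (2 * φ) * h +
        (q ^ 2 - 4 * ε * Real.cos (2 * φ) * h ^ 2) / 2) =
      ε * (Real.cos (2 * φ + 2 * h) - (Real.cos (2 * φ) - 2 * h * Real.sin (2 * φ) -
        (2 * h) ^ 2 / 2 * Real.cos (2 * φ))) := by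
    rw [V, V, mul_add]; ring
  rw [key, abs_mul, abs_of_pos hε]
  rw [h2] at ht
  calc _ ≤ ε * (2 * |h|) ^ 3 := by gcongr
    _ = _ := by ring

theorem energy_eq_of_hasDerivAt (hL : 0 < L) (h : ∀ x, HasDerivAt θ (P x) x) :
    energy ε L U₀ θ = ∫ R in (0 : ℝ)..L, ((P R - U₀) ^ 2 / 2 - V ε (θ R)) := by
  refine intervalIntegral.integral_congr fun R hR => ?_
  rw [uIcc_of_le hL.le] at hR
  simp only [slope_eq_of_hasDerivAt hL (h R) hR]

theorem continuous_V (ε : ℝ) : Continuous (V ε) := by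
  unfold V; fun_prop

/-- An upper bound for the energy of a perturbation of a pendulum solution, when the second
variation is dominated by an exact derivative `G'` and a constant. -/
theorem energy_add_le (hε : 0 < ε) (hL : 0 < L) (hΦ : IsPendulum ε Φ P) {h h' G G' : ℝ → ℝ}
    {C : ℝ} (hh : ∀ x, HasDerivAt h (h' x) x) (hh' : Continuous h')
    (hG : ∀ x, HasDerivAt G (G' x) x) (hG' : Continuous G')
    (hsmall : ∀ R ∈ Icc 0 L, |h R| ≤ 1 / 2)
    (hle : ∀ R ∈ Icc 0 L, (h' R ^ 2 - 4 * ε * Real.cos (2 * Φ R) * h R ^ 2) / 2 +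
      8 * ε * |h R| ^ 3 ≤ G' R + C) :
    energy ε L U₀ (fun R => Φ R + h R) ≤ energy ε L U₀ Φ +
      ((P L - U₀) * h L - (P 0 - U₀) * h 0) + (G L - G 0) + C * L := by
  have hcΦ := hΦ.continuous
  have hcP := hΦ.continuous'
  have hch : Continuous h := continuous_iff_continuousAt.2 fun x => (hh x).continuousAt
  have hcV := continuous_V ε
  rw [energy_eq_of_hasDerivAt hL (fun x => (hΦ.hasDerivAt x).fun_add (hh x)),
    energy_eq_of_hasDerivAt hL hΦ.hasDerivAt]
  -- By the pendulum equation the first variation is the derivative of `(P - U₀) h`, so `D` is an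
  -- exact derivative.
  set D : ℝ → ℝ := fun R =>
    (-(2 * ε * Real.sin (2 * Φ R)) * h R + (P R - U₀) * h' R) + G' R + C with hD
  have hDint : ∫ R in (0 : ℝ)..L, D R =
      ((P L - U₀) * h L + G L + C * L) - ((P 0 - U₀) * h 0 + G 0 + C * 0) := by
    refine intervalIntegral.integral_eq_sub_of_hasDerivAt
      (f := fun R => (P R - U₀) * h R + G R + C * R) (fun R _ => ?_) ?_
    · refine (((((hΦ.hasDerivAt' R).sub_const U₀).mul (hh R)).add (hG R)).add
        ((hasDerivAt_id R).const_mul C)).congr_deriv ?_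
      simp [hD]
    · apply Continuous.intervalIntegrable
      fun_prop
  have hmono : ∫ R in (0 : ℝ)..L, ((P R + h' R - U₀) ^ 2 / 2 - V ε (Φ R + h R)) ≤
      ∫ R in (0 : ℝ)..L, (((P R - U₀) ^ 2 / 2 - V ε (Φ R)) + D R) := by
    refine intervalIntegral.integral_mono_on hL.le ?_ ?_ fun R hR => ?_
    · apply Continuous.intervalIntegrable
      fun_prop
    · apply Continuous.intervalIntegrable
      fun_prop
    · have h1 := (abs_le.1 (abs_energy_density_sub_le hε (Φ R) (P R) U₀ (h' R)
        (hsmall R hR))).2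
      have h2 := hle R hR
      simp only [hD]
      linarith
  rw [intervalIntegral.integral_add] at hmono
  · linarith
  · apply Continuous.intervalIntegrable
    fun_prop
  · apply Continuous.intervalIntegrable
    fun_prop

/-- A strict solution `w` of the Riccati inequality with the right signs at the end points makes
an equilibrium a local minimizer. -/
theorem exists_energy_le_of_riccati (hε : 0 < ε) (hL : 0 < L) (hΦ : IsPendulum ε Φ P)
    (h0 : P 0 = U₀) (h1 : P L = U₀) {w w' : ℝ → ℝ} {c : ℝ} (hc : 0 < c)
    (hw : ∀ R ∈ Icc 0 L, HasDerivAt w (w' R) R) (hw' : ContinuousOn w' (Icc 0 L))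
    (hric : ∀ R ∈ Icc 0 L, w' R + w R ^ 2 + 4 * ε * Real.cos (2 * Φ R) ≤ -c)
    (hw0 : w 0 ≤ 0) (hwL : 0 ≤ w L) :
    ∃ δ > 0, ∀ η : ℝ → ℝ, ContDiffOn ℝ 1 η (Icc 0 L) →
      (∀ R ∈ Icc 0 L, |η R - Φ R| < δ) → energy ε L U₀ Φ ≤ energy ε L U₀ η := by
  -- The bound `1/2` permits the Taylor estimate; `c/(16ε)` makes the cubic remainder at most `(c/2)
  -- h²`. Only uniform closeness of the values is needed, not of the slopes.
  refine ⟨min (1 / 2) (c / (16 * ε)), by positivity, fun η hη hclose => ?_⟩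
  have hcΦ : ContinuousOn Φ (Icc 0 L) := hΦ.continuous.continuousOn
  have hcP : ContinuousOn P (Icc 0 L) := hΦ.continuous'.continuousOn
  have hcη := hη.continuousOn
  have hcw : ContinuousOn w (Icc 0 L) := fun R hR => (hw R hR).continuousAt.continuousWithinAt
  have hcs : ContinuousOn (slope L η) (Icc 0 L) :=
    hη.continuousOn_derivWithin (uniqueDiffOn_Icc hL) le_rfl
  have hdη : ∀ R ∈ Ioo 0 L, HasDerivAt η (slope L η R) R := fun R hR =>
    ((hη.differentiableOn one_ne_zero R (Ioo_subset_Icc_self hR)).hasDerivWithinAt).hasDerivAt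
      (Icc_mem_nhds hR.1 hR.2)
  have hcV := continuous_V ε
  rw [energy_eq_of_hasDerivAt hL hΦ.hasDerivAt, energy]
  -- With `h = η - Φ`, this is the derivative of `(P - U₀) h + w h²/2`.
  set D : ℝ → ℝ := fun R =>
    -(2 * ε * Real.sin (2 * Φ R)) * (η R - Φ R) + (P R - U₀) * (slope L η R - P R) +
      (w' R * (η R - Φ R) ^ 2 + w R * (2 * (η R - Φ R) * (slope L η R - P R))) / 2 with hD
  have hcD : ContinuousOn D (Icc 0 L) := by fun_prop
  have hcE : ContinuousOn (fun R => (P R - U₀) ^ 2 / 2 - V ε (Φ R)) (Icc 0 L) := by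
    fun_prop
  have hDint : ∫ R in (0 : ℝ)..L, D R =
      ((P L - U₀) * (η L - Φ L) + w L * (η L - Φ L) ^ 2 / 2) -
        ((P 0 - U₀) * (η 0 - Φ 0) + w 0 * (η 0 - Φ 0) ^ 2 / 2) := by
    refine intervalIntegral.integral_eq_sub_of_hasDerivAt_of_le hL.le
      (f := fun R => (P R - U₀) * (η R - Φ R) + w R * (η R - Φ R) ^ 2 / 2) (by fun_prop)
      (fun R hR => ?_) (hcD.intervalIntegrable_of_Icc hL.le)
    have hd := (hdη R hR).sub (hΦ.hasDerivAt R)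
    refine ((((hΦ.hasDerivAt' R).sub_const U₀).mul hd).add
      (((hw R (Ioo_subset_Icc_self hR)).mul (hd.pow 2)).div_const 2)).congr_deriv ?_
    simp [hD]
  have hmono : ∫ R in (0 : ℝ)..L, (((P R - U₀) ^ 2 / 2 - V ε (Φ R)) + D R) ≤
      ∫ R in (0 : ℝ)..L, ((slope L η R - U₀) ^ 2 / 2 - V ε (η R)) := by
    refine intervalIntegral.integral_mono_on hL.le
      ((hcE.add hcD).intervalIntegrable_of_Icc hL.le) ?_ fun R hR => ?_
    · exact ContinuousOn.intervalIntegrable_of_Icc hL.le (by fun_prop)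
    · have hs := hclose R hR
      obtain ⟨hs1, hs2⟩ := lt_min_iff.1 hs
      have e1 := (abs_le.1 (abs_energy_density_sub_le hε (Φ R) (P R) U₀ (slope L η R - P R)
        hs1.le)).1
      have e2 := hric R hR
      rw [add_sub_cancel, add_sub_cancel] at e1
      have e3 : 8 * ε * |η R - Φ R| ^ 3 ≤ c / 2 * (η R - Φ R) ^ 2 := by
        rw [lt_div_iff₀ (by positivity)] at hs2
        have : |η R - Φ R| ^ 3 = |η R - Φ R| * (η R - Φ R) ^ 2 := by
          rw [← sq_abs (η R - Φ R)]; ring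
        rw [this]
        nlinarith [sq_nonneg (η R - Φ R)]
      simp only [hD]
      -- Completing the square: the second variation density minus `(w h²)'/2` is `((h' - w h)² -
      -- (w' + w² + 4ε cos 2Φ) h²)/2 ≥ c h²/2`.
      nlinarith [sq_nonneg ((slope L η R - P R) - w R * (η R - Φ R)),
        mul_le_mul_of_nonneg_right e2 (sq_nonneg (η R - Φ R))]
  rw [intervalIntegral.integral_add (hcE.intervalIntegrable_of_Icc hL.le)
    (hcD.intervalIntegrable_of_Icc hL.le), hDint, h0, h1] at hmono
  have := mul_nonneg hwL (sq_nonneg (η L - Φ L))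
  have := mul_nonneg (neg_nonneg.2 hw0) (sq_nonneg (η 0 - Φ 0))
  linarith

end Ladder

/-! ### Stability and instability according to the amplitude. -/

namespace Ladder

variable {ε L U₀ ν : ℝ} {θ : ℝ → ℝ}

theorem not_isLocalMinimizer_of_exists (hL : 0 < L)
    (h : ∀ δ > 0, ∃ η η' : ℝ → ℝ, (∀ x, HasDerivAt η (η' x) x) ∧ Continuous η' ∧
      (∀ R ∈ Icc 0 L, |η R - θ R| < δ ∧ |η' R - slope L θ R| < δ) ∧
      energy ε L U₀ η < energy ε L U₀ θ) : ¬ IsLocalMinimizer ε L U₀ θ := by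
  rintro ⟨δ, hδ, hmin⟩
  obtain ⟨η, η', hd, hc, hclose, hlt⟩ := h δ hδ
  refine hlt.not_ge (hmin η ?_ fun R hR => ?_)
  · refine (contDiff_one_iff_deriv.2 ⟨fun x => (hd x).differentiableAt, ?_⟩).contDiffOn
    rwa [show deriv η = η' from funext fun x => (hd x).deriv]
  · rw [slope_eq_of_hasDerivAt hL (hd R) hR]
    exact hclose R hR

namespace IsPendulum

variable {Φ P : ℝ → ℝ}

theorem hasDerivAt_acceleration (h : IsPendulum ε Φ P) (x : ℝ) :
    HasDerivAt (fun x => -(2 * ε * Real.sin (2 * Φ x)))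
      (-(4 * ε * Real.cos (2 * Φ x) * P x)) x := by
  refine ((((h.hasDerivAt x).const_mul 2).sin).const_mul (2 * ε)).neg.congr_deriv ?_
  ring

end IsPendulum

namespace IsPerversion

theorem isStable_of_pos (hε : 0 < ε) (hL : 0 < L) (h : IsPerversion ε L θ)
    (hν : HasParameter ε L θ ν) (hp : 0 < slope L θ (L / 2)) (he : IsEquilibrium ε L U₀ θ)
    (ha : Real.pi / 2 < θ L) (hb : θ L < Real.pi) : IsStable ε L U₀ θ := by
  refine ⟨he, ?_⟩
  have hν0 : 0 < ν := by
    by_contra! hc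
    exact ha.not_ge (h.apply_le_of_nonpos hε hL hν hp hc)
  obtain ⟨Φ, P, hΦ, heq, -, -⟩ := h.exists_isPendulum hε hL hν hp
  have hmem0 : (0 : ℝ) ∈ Icc 0 L := ⟨le_rfl, hL.le⟩
  have hmemL : L ∈ Icc 0 L := ⟨hL.le, le_rfl⟩
  have hP2 : ∀ R ∈ Icc 0 L, P R ^ 2 = 4 * ε * (ν + Real.cos (Φ R) ^ 2) := fun R hR => by
    rw [← (heq R hR).2, ← (heq R hR).1, hν.slope_sq hε hR]
  have hlow : ∀ R ∈ Icc 0 L, 4 * ε * ν ≤ P R ^ 2 := fun R hR => by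
    rw [hP2 R hR]
    have := mul_nonneg (by positivity : 0 ≤ 4 * ε) (sq_nonneg (Real.cos (Φ R)))
    linarith
  have hup : ∀ R ∈ Icc 0 L, P R ^ 2 ≤ 4 * ε * (ν + 1) := fun R hR => by
    rw [hP2 R hR]
    have := Real.cos_sq_le_one (Φ R)
    gcongr
  have hb0 : 0 < 4 * ε * ν := by positivity
  have hPpos : ∀ R ∈ Icc 0 L, 0 < P R := fun R hR => by
    have h1 : 0 ≤ P R := by rw [← (heq R hR).2]; exact h.slope_nonneg hL hp hR
    exact (sq_pos_iff.1 (hb0.trans_le (hlow R hR))).lt_of_le' h1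
  have hP0 : P 0 = U₀ := by rw [← (heq 0 hmem0).2, he.2.1]
  have hPL : P L = U₀ := by rw [← (heq L hmemL).2, he.2.2]
  have hU : 0 < U₀ := hPL ▸ hPpos L hmemL
  have hΦ0 : Φ 0 = -θ L := by rw [← (heq 0 hmem0).1, h.apply_zero hL]
  have hΦL : Φ L = θ L := (heq L hmemL).1.symm
  set S := -Real.sin (2 * θ L) with hS
  have hSpos : 0 < S := by
    rw [hS, ← Real.sin_sub_pi]
    exact Real.sin_pos_of_pos_of_lt_pi (by linarith) (by linarith)
  -- The first bound keeps the strict Riccati inequality, the second preserves the end-point signs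
  -- of `w`.
  obtain ⟨δ, hδ, hδ1, hδ2⟩ : ∃ δ > 0, δ * L ^ 2 ≤ 2 * (4 * ε * ν) ∧ δ * L ≤ 4 * ε * S * U₀ := by
    refine ⟨min (2 * (4 * ε * ν) / L ^ 2) (4 * ε * S * U₀ / L), by positivity, ?_, ?_⟩
    · rw [← le_div_iff₀ (by positivity)]; exact min_le_left _ _
    · rw [← le_div_iff₀ (by positivity)]; exact min_le_right _ _
  set q : ℝ → ℝ := fun x => -(2 * ε * Real.sin (2 * Φ x)) with hq
  have hcΦ := hΦ.continuous
  have hcP := hΦ.continuous'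
  have hcq : Continuous q := by fun_prop
  obtain ⟨δ', hδ', hmin⟩ := exists_energy_le_of_riccati hε hL hΦ hP0 hPL
    -- This is `P'/P - δ (R - L/2)/P²`. The first term solves the Riccati equation; in the perturbed
    -- expression the cross terms cancel, leaving `-(δ/P²)(1 - δ (R - L/2)²/P²)`.
    (w := fun R => (q R * P R - δ * (R - L / 2)) / P R ^ 2)
    (w' := fun R => ((-(4 * ε * Real.cos (2 * Φ R) * P R) * P R + q R * q R - δ) * P R ^ 2 -
      (q R * P R - δ * (R - L / 2)) * (2 * P R * q R)) / (P R ^ 2) ^ 2)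
    (c := δ / (2 * (4 * ε * (ν + 1)))) (by positivity)
    (fun R hR => by
      have hd := (((hΦ.hasDerivAt_acceleration R).mul (hΦ.hasDerivAt' R)).sub
        (((hasDerivAt_id R).sub_const (L / 2)).const_mul δ)).div ((hΦ.hasDerivAt' R).pow 2)
        (pow_pos (hPpos R hR) 2).ne'
      refine hd.congr_deriv ?_
      simp [hq])
    (by
      refine ContinuousOn.div (by fun_prop) (by fun_prop) fun R hR => ?_
      have := hPpos R hR
      positivity)
    (fun R hR => by
      have hPR := hPpos R hR
      have e1 := hlow R hR
      have e2 := hup R hR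
      have hx : δ * (R - L / 2) ^ 2 ≤ P R ^ 2 / 2 := by
        have : (R - L / 2) ^ 2 ≤ L ^ 2 / 4 := by nlinarith [hR.1, hR.2]
        nlinarith
      have key : ((-(4 * ε * Real.cos (2 * Φ R) * P R) * P R + q R * q R - δ) * P R ^ 2 -
          (q R * P R - δ * (R - L / 2)) * (2 * P R * q R)) / (P R ^ 2) ^ 2 +
          ((q R * P R - δ * (R - L / 2)) / P R ^ 2) ^ 2 + 4 * ε * Real.cos (2 * Φ R) =
          -(δ / P R ^ 2) * (1 - δ * (R - L / 2) ^ 2 / P R ^ 2) := by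
        field_simp
        ring
      rw [key]
      have hy : δ * (R - L / 2) ^ 2 / P R ^ 2 ≤ 1 / 2 := by
        rw [div_le_iff₀ (by positivity)]; linarith
      have hz : δ / (4 * ε * (ν + 1)) ≤ δ / P R ^ 2 := by gcongr
      have hz0 : 0 < δ / P R ^ 2 := by positivity
      have : δ / (2 * (4 * ε * (ν + 1))) = δ / (4 * ε * (ν + 1)) / 2 := by
        field_simp
      rw [this]
      nlinarith)
    (by
      apply div_nonpos_of_nonpos_of_nonneg _ (sq_nonneg _)
      have : q 0 = -(2 * ε * S) := by simp [hq, hΦ0, hS]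
      rw [this, hP0]
      linarith)
    (by
      apply div_nonneg _ (sq_nonneg _)
      have : q L = 2 * ε * S := by simp [hq, hΦL, hS]
      rw [this, hPL]
      linarith)
  refine ⟨δ', hδ', fun η hη hclose => ?_⟩
  rw [energy_congr hL fun R hR => (heq R hR).1]
  refine hmin η hη fun R hR => ?_
  rw [← (heq R hR).1]
  exact (hclose R hR).1

theorem not_isLocalMinimizer_of_lt (hε : 0 < ε) (hL : 0 < L) (h : IsPerversion ε L θ)
    (hν : HasParameter ε L θ ν) (hp : 0 < slope L θ (L / 2)) (he : IsEquilibrium ε L U₀ θ)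
    (ha : θ L < Real.pi / 2) : ¬ IsLocalMinimizer ε L U₀ θ := by
  obtain ⟨Φ, P, hΦ, heq, -, -⟩ := h.exists_isPendulum hε hL hν hp
  have hmem0 : (0 : ℝ) ∈ Icc 0 L := ⟨le_rfl, hL.le⟩
  have hmemL : L ∈ Icc 0 L := ⟨hL.le, le_rfl⟩
  have hP0 : P 0 = U₀ := by rw [← (heq 0 hmem0).2, he.2.1]
  have hPL : P L = U₀ := by rw [← (heq L hmemL).2, he.2.2]
  have hU : 0 ≤ U₀ := he.2.2 ▸ h.slope_nonneg hL hp hmemL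
  have hΦ0 : Φ 0 = -θ L := by rw [← (heq 0 hmem0).1, h.apply_zero hL]
  have hΦL : Φ L = θ L := (heq L hmemL).1.symm
  set S := Real.sin (2 * θ L) with hS
  have hSpos : 0 < S :=
    Real.sin_pos_of_pos_of_lt_pi (by linarith [h.apply_pos hL hp]) (by linarith)
  have hcΦ := hΦ.continuous
  have hcP := hΦ.continuous'
  -- In the direction `P + s` the bound on the quadratic part is `t²(-2ε S U₀ - 4ε s S + 2ε s² L)`.
  -- The choice `s = S/L` minimizes it and keeps it negative even when `U₀ = 0`.
  set s := S / L with hs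
  set q : ℝ → ℝ := fun x => -(2 * ε * Real.sin (2 * Φ x)) with hq
  have hcq : Continuous q := by fun_prop
  obtain ⟨M₁, hM₁⟩ := isCompact_Icc.exists_bound_of_continuousOn
    (s := Icc 0 L) (f := fun R => P R + s) (by fun_prop)
  obtain ⟨M₂, hM₂⟩ := isCompact_Icc.exists_bound_of_continuousOn
    (s := Icc 0 L) (f := q) (by fun_prop)
  set M := max 1 (max M₁ M₂) with hM
  have hM1 : 1 ≤ M := le_max_left _ _
  have hMP : ∀ R ∈ Icc 0 L, |P R + s| ≤ M := fun R hR =>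
    (hM₁ R hR).trans ((le_max_left _ _).trans (le_max_right _ _))
  have hMq : ∀ R ∈ Icc 0 L, |q R| ≤ M := fun R hR =>
    (hM₂ R hR).trans ((le_max_right _ _).trans (le_max_right _ _))
  have hM0 : 0 < M := by linarith
  refine not_isLocalMinimizer_of_exists hL fun δ hδ => ?_
  obtain ⟨t, ht, ht1, ht2, ht3⟩ : ∃ t > 0, t * M ≤ 1 / 2 ∧ t * M < δ ∧
      t * (4 * L ^ 2 * M ^ 3) < S ^ 2 := by
    refine ⟨min (1 / 2 / M) (min (δ / 2 / M) (S ^ 2 / 2 / (4 * L ^ 2 * M ^ 3))), by positivity,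
      ?_, ?_, ?_⟩
    · rw [← le_div_iff₀ hM0]; exact min_le_left _ _
    · refine lt_of_le_of_lt ?_ (half_lt_self hδ)
      rw [← le_div_iff₀ hM0]; exact (min_le_right _ _).trans (min_le_left _ _)
    · refine lt_of_le_of_lt ?_ (half_lt_self (by positivity : 0 < S ^ 2))
      rw [← le_div_iff₀ (by positivity)]; exact (min_le_right _ _).trans (min_le_right _ _)
  have habs : ∀ R ∈ Icc 0 L, |t * (P R + s)| ≤ t * M := fun R hR => by
    rw [abs_mul, abs_of_pos ht]
    exact mul_le_mul_of_nonneg_left (hMP R hR) ht.le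
  have hdh : ∀ x, HasDerivAt (fun R => t * (P R + s)) (t * q x) x := fun x =>
    ((hΦ.hasDerivAt' x).add_const s).const_mul t
  refine ⟨fun R => Φ R + t * (P R + s), fun R => P R + t * q R,
    fun x => (hΦ.hasDerivAt x).fun_add (hdh x), by fun_prop, fun R hR => ⟨?_, ?_⟩, ?_⟩
  · rw [(heq R hR).1, add_sub_cancel_left]
    exact (habs R hR).trans_lt ht2
  · rw [(heq R hR).2, add_sub_cancel_left, abs_mul, abs_of_pos ht]
    exact (mul_le_mul_of_nonneg_left (hMq R hR) ht.le).trans_lt ht2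
  · have key := energy_add_le (U₀ := U₀) hε hL hΦ hdh (by fun_prop)
      -- As `P'' = -4ε cos(2Φ) P`, the second variation density of `t (P + s)` is `G' - 2ε t² s²
      -- cos(2Φ)`.
      (G := fun R => t ^ 2 / 2 * ((P R + 2 * s) * q R))
      (G' := fun R => t ^ 2 / 2 *
        (q R * q R + (P R + 2 * s) * -(4 * ε * Real.cos (2 * Φ R) * P R)))
      (C := 2 * ε * t ^ 2 * s ^ 2 + 8 * ε * (t * M) ^ 3)
      (fun x => (((hΦ.hasDerivAt' x).add_const (2 * s)).mul
        (hΦ.hasDerivAt_acceleration x)).const_mul (t ^ 2 / 2)) (by fun_prop)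
      (fun R hR => (habs R hR).trans ht1) (fun R hR => by
        have e1 : |t * (P R + s)| ^ 3 ≤ (t * M) ^ 3 :=
          pow_le_pow_left₀ (abs_nonneg _) (habs R hR) 3
        have e2 : 8 * ε * |t * (P R + s)| ^ 3 ≤ 8 * ε * (t * M) ^ 3 := by gcongr
        have e3 := mul_nonneg (by positivity : 0 ≤ 2 * ε * t ^ 2 * s ^ 2)
          (by linarith [Real.neg_one_le_cos (2 * Φ R)] : 0 ≤ 1 + Real.cos (2 * Φ R))
        nlinarith)
    have hqL : q L = -(2 * ε * S) := by simp [hq, hΦL, hS]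
    have hq0 : q 0 = 2 * ε * S := by simp [hq, hΦ0, hS]
    simp only [hqL, hq0, hP0, hPL] at key
    rw [energy_congr hL fun R hR => (heq R hR).1]
    refine key.trans_lt ?_
    have hsL : s * L = S := by rw [hs]; field_simp
    have e1 : 2 * ε * t ^ 2 * s ^ 2 * L = 2 * ε * t ^ 2 * s * S := by rw [← hsL]; ring
    have e2 : 0 ≤ 2 * ε * t ^ 2 * S * U₀ := by positivity
    have e3 : 8 * ε * (t * M) ^ 3 * L < 2 * ε * t ^ 2 * s * S := by
      have e4 : 2 * ε * t ^ 2 * s * S = 2 * ε * t ^ 2 / L * S ^ 2 := by rw [hs]; field_simp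
      have e5 : 8 * ε * (t * M) ^ 3 * L = 2 * ε * t ^ 2 / L * (t * (4 * L ^ 2 * M ^ 3)) := by
        field_simp; ring
      rw [e4, e5]
      gcongr
    linarith

theorem not_isLocalMinimizer_of_eq (hε : 0 < ε) (hL : 0 < L) (h : IsPerversion ε L θ)
    (hν : HasParameter ε L θ ν) (hp : 0 < slope L θ (L / 2)) (he : IsEquilibrium ε L U₀ θ)
    (ha : θ L = Real.pi / 2) : ¬ IsLocalMinimizer ε L U₀ θ := by
  obtain ⟨Φ, P, hΦ, heq, -, -⟩ := h.exists_isPendulum hε hL hν hp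
  have hmem0 : (0 : ℝ) ∈ Icc 0 L := ⟨le_rfl, hL.le⟩
  have hmemL : L ∈ Icc 0 L := ⟨hL.le, le_rfl⟩
  have hP0 : P 0 = U₀ := by rw [← (heq 0 hmem0).2, he.2.1]
  have hPL : P L = U₀ := by rw [← (heq L hmemL).2, he.2.2]
  have hU : 0 ≤ U₀ := he.2.2 ▸ h.slope_nonneg hL hp hmemL
  have hΦ0 : Φ 0 = -(Real.pi / 2) := by rw [← (heq 0 hmem0).1, h.apply_zero hL, ha]
  have hΦL : Φ L = Real.pi / 2 := by rw [← (heq L hmemL).1, ha]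
  have hcΦ := hΦ.continuous
  have hcP := hΦ.continuous'
  -- The ends differ by `π` and have equal slopes, so translation by `L` adds `π`.
  obtain ⟨hperΦ, hperP⟩ := (hΦ.comp_add L).sub_pi.unique hε hΦ (x₀ := 0)
    (by simp only [zero_add, hΦ0, hΦL]; ring) (by simp only [zero_add, hP0, hPL])
  have hperΦ' : ∀ x, Φ (x + L) = Φ x + Real.pi := fun x => by
    linarith [congrFun hperΦ x]
  have hperP' : ∀ x, P (x + L) = P x := congrFun hperP
  have hperiodic : Function.Periodic (fun R => (P R - U₀) ^ 2 / 2 - V ε (Φ R)) L := by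
    intro x
    have : V ε (Φ x + Real.pi) = V ε (Φ x) := by
      rw [V, V, mul_add, Real.cos_add_two_pi]
    simp only [hperP', hperΦ', this]
  have henergy : ∀ c, energy ε L U₀ (fun x => Φ (x + c)) = energy ε L U₀ Φ := by
    intro c
    rw [energy_eq_of_hasDerivAt hL (hΦ.comp_add c).hasDerivAt,
      energy_eq_of_hasDerivAt hL hΦ.hasDerivAt,
      intervalIntegral.integral_comp_add_right (fun R => (P R - U₀) ^ 2 / 2 - V ε (Φ R)) c,
      zero_add, add_comm L c, hperiodic.intervalIntegral_add_eq c 0, zero_add]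
  have hPc : ∀ c ∈ Ioo 0 L, U₀ < P c := by
    intro c hc
    have hcI := Ioo_subset_Icc_self hc
    have hm := h.strictMonoOn hL hp
    have h1 := hm hmem0 hcI hc.1
    have h2 := hm hcI hmemL hc.2
    rw [h.apply_zero hL, ha] at h1
    rw [ha] at h2
    have hcos := Real.cos_pos_of_mem_Ioo ⟨h1, h2⟩
    rw [← (heq c hcI).2]
    refine lt_of_pow_lt_pow_left₀ 2 (h.slope_nonneg hL hp hcI) ?_
    rw [← he.2.2, hν.slope_sq hε hmemL, hν.slope_sq hε hcI, ha, Real.cos_pi_div_two]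
    gcongr
  refine not_isLocalMinimizer_of_exists hL fun δ hδ => ?_
  obtain ⟨c, hc, hcclose⟩ : ∃ c ∈ Ioo 0 L, ∀ R ∈ Icc 0 L,
      |Φ (R + c) - Φ R| < δ / 2 ∧ |P (R + c) - P R| < δ / 2 := by
    have hu1 := Metric.uniformContinuousOn_iff.1
      ((isCompact_Icc (a := 0) (b := 2 * L)).uniformContinuousOn_of_continuous
        (f := Φ) hcΦ.continuousOn) (δ / 2) (by positivity)
    have hu2 := Metric.uniformContinuousOn_iff.1
      ((isCompact_Icc (a := 0) (b := 2 * L)).uniformContinuousOn_of_continuous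
        (f := P) hcP.continuousOn) (δ / 2) (by positivity)
    obtain ⟨d₁, hd₁, hu1⟩ := hu1
    obtain ⟨d₂, hd₂, hu2⟩ := hu2
    have hmpos : 0 < min L (min d₁ d₂) := by positivity
    set c := min L (min d₁ d₂) / 2 with hcdef
    have hc0 : 0 < c := by positivity
    have hclt : c < min L (min d₁ d₂) := half_lt_self hmpos
    have hcL : c < L := hclt.trans_le (min_le_left _ _)
    refine ⟨c, ⟨hc0, hcL⟩, fun R hR => ?_⟩
    have m1 : R + c ∈ Icc 0 (2 * L) := ⟨by linarith [hR.1], by linarith [hR.2]⟩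
    have m2 : R ∈ Icc 0 (2 * L) := ⟨hR.1, by linarith [hR.2]⟩
    have hdist : dist (R + c) R = c := by
      rw [Real.dist_eq, add_sub_cancel_left, abs_of_pos hc0]
    refine ⟨hu1 _ m1 _ m2 ?_, hu2 _ m1 _ m2 ?_⟩ <;> rw [hdist]
    · exact hclt.trans_le ((min_le_right _ _).trans (min_le_left _ _))
    · exact hclt.trans_le ((min_le_right _ _).trans (min_le_right _ _))
  have hgap : 0 < P c - U₀ := sub_pos.2 (hPc c hc)
  -- Bounds the quadratic and cubic terms for `h = -t R`, `t ≤ 1`, by `t² A`. The linear term `-t L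
  -- (P c - U₀)`, nonzero because the translate has end slopes `P c > U₀`, then dominates.
  set A := 1 / 2 + 2 * ε * L ^ 2 + 8 * ε * L ^ 3 with hA
  have hApos : 0 < A := by positivity
  obtain ⟨t, ht, ht1, ht2, ht3, ht4⟩ : ∃ t > 0, t ≤ 1 ∧ t * L ≤ 1 / 2 ∧
      t * (L + 1) < δ / 2 ∧ t * A < P c - U₀ := by
    refine ⟨min (min 1 (1 / 2 / L)) (min (δ / 2 / 2 / (L + 1)) ((P c - U₀) / 2 / A)),
      by positivity, (min_le_left _ _).trans (min_le_left _ _), ?_, ?_, ?_⟩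
    · rw [← le_div_iff₀ hL]; exact (min_le_left _ _).trans (min_le_right _ _)
    · refine lt_of_le_of_lt ?_ (half_lt_self (half_pos hδ))
      rw [← le_div_iff₀ (by positivity)]; exact (min_le_right _ _).trans (min_le_left _ _)
    · refine lt_of_le_of_lt ?_ (half_lt_self hgap)
      rw [← le_div_iff₀ hApos]; exact (min_le_right _ _).trans (min_le_right _ _)
  have habs : ∀ R ∈ Icc 0 L, |-t * R| ≤ t * L := fun R hR => by
    rw [abs_mul, abs_neg, abs_of_pos ht, abs_of_nonneg hR.1]
    exact mul_le_mul_of_nonneg_left hR.2 ht.le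
  have hdh : ∀ x, HasDerivAt (fun R => -t * R) (-t) x := fun x => by
    simpa using (hasDerivAt_id x).const_mul (-t)
  have hΨ := hΦ.comp_add c
  refine ⟨fun R => Φ (R + c) + -t * R, fun R => P (R + c) + -t,
    fun x => (hΨ.hasDerivAt x).fun_add (hdh x), by fun_prop, fun R hR => ⟨?_, ?_⟩, ?_⟩
  · rw [(heq R hR).1, add_sub_right_comm]
    refine (abs_add_le _ _).trans_lt ?_
    linarith [(hcclose R hR).1, habs R hR]
  · rw [(heq R hR).2, add_sub_right_comm]
    refine (abs_add_le _ _).trans_lt ?_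
    rw [abs_neg, abs_of_pos ht]
    have := mul_pos ht hL
    linarith [(hcclose R hR).2]
  · have key := energy_add_le (U₀ := U₀) hε hL hΨ hdh continuous_const
      (G := fun _ => 0) (G' := fun _ => 0) (C := t ^ 2 * A)
      (fun x => hasDerivAt_const x 0) continuous_const
      (fun R hR => (habs R hR).trans ht2) (fun R hR => by
        have e1 : |-t * R| ^ 3 ≤ (t * L) ^ 3 :=
          pow_le_pow_left₀ (abs_nonneg _) (habs R hR) 3
        have e2 : 8 * ε * |-t * R| ^ 3 ≤ 8 * ε * (t * L) ^ 3 := by gcongr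
        have e3 : (-t * R) ^ 2 ≤ (t * L) ^ 2 := by
          rw [← sq_abs]; exact pow_le_pow_left₀ (abs_nonneg _) (habs R hR) 2
        have e4 : -(2 * ε * Real.cos (2 * Φ (R + c)) * (-t * R) ^ 2) ≤ 2 * ε * (t * L) ^ 2 := by
          have := mul_nonneg (by positivity : 0 ≤ 2 * ε * (-t * R) ^ 2)
            (by linarith [Real.neg_one_le_cos (2 * Φ (R + c))] :
              0 ≤ 1 + Real.cos (2 * Φ (R + c)))
          nlinarith
        have e5 : 8 * ε * (t * L) ^ 3 ≤ t ^ 2 * (8 * ε * L ^ 3) := by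
          have : t ^ 3 ≤ t ^ 2 := pow_le_pow_of_le_one ht.le ht1 (by norm_num)
          have e6 := mul_le_mul_of_nonneg_left this (by positivity : 0 ≤ 8 * ε * L ^ 3)
          linarith
        rw [hA]
        nlinarith)
    rw [henergy] at key
    rw [energy_congr hL fun R hR => (heq R hR).1]
    refine key.trans_lt ?_
    have hPLc : P (L + c) = P c := by rw [add_comm, hperP']
    rw [hPLc]
    have := mul_lt_mul_of_pos_left ht4 (mul_pos ht hL)
    nlinarith

end IsPerversion

end Ladder

/-! ### From amplitude to parameter: the criteria and existence. -/

theorem ellipticF_pi {m : ℝ} (hm : 0 ≤ m) (hm1 : m < 1) :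
    ellipticF Real.pi m = 2 * ellipticK m := by
  have hc : Continuous fun t => 1 / Real.sqrt (1 - m * Real.sin t ^ 2) := by
    refine Continuous.div continuous_const (by fun_prop) fun t => ?_
    refine (Real.sqrt_pos.2 ?_).ne'
    nlinarith [Real.sin_sq_le_one t, sq_nonneg (Real.sin t)]
  have h1 := intervalIntegral.integral_add_adjacent_intervals
    (hc.intervalIntegrable (μ := MeasureTheory.volume) 0 (Real.pi / 2))
    (hc.intervalIntegrable (Real.pi / 2) Real.pi)
  have h2 := intervalIntegral.integral_comp_sub_left (a := 0) (b := Real.pi / 2)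
    (fun t => 1 / Real.sqrt (1 - m * Real.sin t ^ 2)) Real.pi
  simp only [Real.sin_pi_sub, sub_zero, sub_half] at h2
  rw [ellipticK, ellipticF, ellipticF, ← h1, ← h2]
  ring

namespace Ladder

variable {ε L U₀ ν : ℝ} {θ : ℝ → ℝ}

namespace IsPerversion

theorem admissible_iff_of_pos (hε : 0 < ε) (hL : 0 < L) (h : IsPerversion ε L θ)
    (hν : HasParameter ε L θ ν) (hp : 0 < slope L θ (L / 2)) :
    Admissible ε L ν ↔ Real.pi / 2 < θ L ∧ θ L < Real.pi := by
  rcases le_or_gt ν 0 with hν0 | hν0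
  · have := h.apply_le_of_nonpos hε hL hν hp hν0
    exact ⟨fun ha => absurd ha.1 hν0.not_gt, fun ha => absurd ha.1 this.not_gt⟩
  · obtain ⟨-, -, -, -, -, hF⟩ := h.exists_isPendulum hε hL hν hp
    have hF := hF hν0
    have hm : 0 ≤ 1 / (1 + ν) := by positivity
    have hm1 : 1 / (1 + ν) < 1 := by rw [div_lt_one (by linarith)]; linarith
    have hmem : ∀ x, x ∈ ellipticDomain (1 / (1 + ν)) := fun x => by
      rw [ellipticDomain_of_lt_one hm hm1]; trivial
    have hmono := ellipticF_strictMonoOn hm hm1.le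
    have hr : 0 < Real.sqrt (1 + ν) := Real.sqrt_pos.2 (by linarith)
    have e1 := hmono.lt_iff_lt (hmem (Real.pi / 2)) (hmem (θ L))
    have e2 := hmono.lt_iff_lt (hmem (θ L)) (hmem Real.pi)
    simp only [hF, ellipticF_pi hm hm1] at e1 e2
    have e3 : k ν < Real.sqrt ε * L ↔ Real.pi / 2 < θ L := by
      rw [← e1, k, div_lt_iff₀ hr]; rfl
    have e4 : Real.sqrt ε * L / 2 < k ν ↔ θ L < Real.pi := by
      rw [← e2, k, lt_div_iff₀ hr]
      constructor <;> intro <;> linarith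
    rw [Admissible, e3, e4]
    exact ⟨fun ha => ⟨ha.2.2, ha.2.1⟩, fun ha => ⟨hν0, ha.2, ha.1⟩⟩

theorem setOf_sin_eq_zero (hL : 0 < L) (h : IsPerversion ε L θ) (hp : 0 < slope L θ (L / 2))
    (ha : θ L < Real.pi) : {R ∈ Icc 0 L | Real.sin (θ R) = 0} = {L / 2} := by
  have hmem : L / 2 ∈ Icc 0 L := ⟨by linarith, by linarith⟩
  ext R
  simp only [mem_ofPred_eq, mem_singleton_iff]
  constructor
  · rintro ⟨hR, hs⟩
    obtain ⟨h1, h2⟩ := abs_lt.1 ((h.abs_apply_le hL hp hR).trans_lt ha)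
    rw [Real.sin_eq_zero_iff_of_lt_of_lt h1 h2, ← h.apply_half hL] at hs
    exact (h.strictMonoOn hL hp).injOn hR hmem hs
  · rintro rfl
    exact ⟨hmem, by rw [h.apply_half hL, Real.sin_zero]⟩

theorem stabilityIndex_of_lt (hε : 0 < ε) (hL : 0 < L) (h : IsPerversion ε L θ)
    (hp : 0 < slope L θ (L / 2)) (ha : θ L < Real.pi / 2) : stabilityIndex ε L θ = 1 := by
  have hempty : {R ∈ Icc 0 L | Real.cos (θ R) = 0} = ∅ := by
    refine eq_empty_of_forall_notMem fun R hR => ?_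
    exact (Real.cos_pos_of_mem_Ioo (abs_lt.1 ((h.abs_apply_le hL hp hR.1).trans_lt ha))).ne' hR.2
  rw [stabilityIndex_eq hε, h.setOf_sin_eq_zero hL hp (by linarith [Real.pi_pos]), hempty]
  simp

/-- The monotone trajectory meets `0` once and each of `±π/2` once, so the index is `1 - 2`. -/
theorem stabilityIndex_of_gt (hε : 0 < ε) (hL : 0 < L) (h : IsPerversion ε L θ)
    (hp : 0 < slope L θ (L / 2)) (ha : Real.pi / 2 < θ L) (hb : θ L < Real.pi) :
    stabilityIndex ε L θ = -1 := by
  have hpi := Real.pi_pos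
  have hinj := (h.strictMonoOn hL hp).injOn
  obtain ⟨x, hx, hx2⟩ := intermediate_value_Icc (show L / 2 ≤ L by linarith)
    (h.1.continuousOn.mono (Icc_subset_Icc (by linarith) le_rfl))
    (show Real.pi / 2 ∈ Icc (θ (L / 2)) (θ L) from
      ⟨by rw [h.apply_half hL]; positivity, ha.le⟩)
  have hxI : x ∈ Icc 0 L := ⟨by linarith [hx.1], hx.2⟩
  have hyI : L - x ∈ Icc 0 L := ⟨by linarith [hx.2], by linarith [hxI.1]⟩
  have hy2 : θ (L - x) = -(Real.pi / 2) := by rw [h.2.1 x hxI, hx2]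
  have hset : {R ∈ Icc 0 L | Real.cos (θ R) = 0} = {x, L - x} := by
    ext R
    simp only [mem_ofPred_eq, mem_insert_iff, mem_singleton_iff]
    constructor
    · rintro ⟨hR, hs⟩
      have h1 := (h.abs_apply_le hL hp hR).trans_lt hb
      rw [← Real.cos_abs, ← Real.cos_pi_div_two] at hs
      have h2 := Real.injOn_cos ⟨abs_nonneg _, h1.le⟩ ⟨by positivity, by linarith⟩ hs
      rcases (abs_eq (by positivity)).1 h2 with h3 | h3
      · exact Or.inl (hinj hR hxI (h3.trans hx2.symm))
      · exact Or.inr (hinj hR hyI (h3.trans hy2.symm))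
    · rintro (rfl | rfl)
      · exact ⟨hxI, by rw [hx2, Real.cos_pi_div_two]⟩
      · exact ⟨hyI, by rw [hy2, Real.cos_neg, Real.cos_pi_div_two]⟩
  have hne : x ≠ L - x := fun hc => by
    rw [← hc, hx2] at hy2
    linarith
  rw [stabilityIndex_eq hε, h.setOf_sin_eq_zero hL hp hb, hset, ncard_pair hne]
  simp

/-- At amplitude exactly `π/2` both end points lie on maxima of `V` and are counted, so the index
would again be `-1`; hence the exclusion. -/
theorem index_criterion_of_pos (hε : 0 < ε) (hL : 0 < L) (h : IsPerversion ε L θ)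
    (hν : HasParameter ε L θ ν) (hp : 0 < slope L θ (L / 2)) :
    (stabilityIndex ε L θ = -1 ∧ |θ L| ≠ Real.pi / 2 ∧ NoFlangeContact L θ) ↔
      Admissible ε L ν := by
  rw [h.admissible_iff_of_pos hε hL hν hp, h.noFlangeContact_iff hL hp,
    abs_of_pos (h.apply_pos hL hp)]
  constructor
  · rintro ⟨h1, h2, h3⟩
    refine ⟨lt_of_le_of_ne ?_ h2.symm, h3⟩
    by_contra! hc
    rw [h.stabilityIndex_of_lt hε hL hp hc] at h1
    norm_num at h1
  · rintro ⟨h1, h2⟩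
    exact ⟨h.stabilityIndex_of_gt hε hL hp h1 h2, h1.ne', h2⟩

theorem stability_criterion_of_pos (hε : 0 < ε) (hL : 0 < L) (h : IsPerversion ε L θ)
    (hν : HasParameter ε L θ ν) (hp : 0 < slope L θ (L / 2)) (he : IsEquilibrium ε L U₀ θ) :
    (IsStable ε L U₀ θ ∧ NoFlangeContact L θ) ↔ Admissible ε L ν := by
  rw [h.admissible_iff_of_pos hε hL hν hp, h.noFlangeContact_iff hL hp]
  constructor
  · rintro ⟨h1, h2⟩
    refine ⟨?_, h2⟩
    by_contra! hc
    rcases hc.lt_or_eq with hc | hc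
    · exact h.not_isLocalMinimizer_of_lt hε hL hν hp he hc h1.2
    · exact h.not_isLocalMinimizer_of_eq hε hL hν hp he hc h1.2
  · rintro ⟨h1, h2⟩
    exact ⟨h.isStable_of_pos hε hL hν hp he h1 h2, h2⟩

theorem slope_half_pos_or (hL : 0 < L) (h : IsPerversion ε L θ) :
    0 < slope L θ (L / 2) ∨ 0 < slope L (fun R => -θ R) (L / 2) := by
  rw [slope_neg, neg_pos]
  exact (h.2.2 (L / 2) ⟨by linarith, by linarith⟩).symm.lt_or_gt

theorem index_criterion (hε : 0 < ε) (hL : 0 < L) (h : IsPerversion ε L θ)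
    (hν : HasParameter ε L θ ν) :
    (stabilityIndex ε L θ = -1 ∧ |θ L| ≠ Real.pi / 2 ∧ NoFlangeContact L θ) ↔
      Admissible ε L ν := by
  rcases h.slope_half_pos_or hL with hp | hp
  · exact h.index_criterion_of_pos hε hL hν hp
  · rw [← h.neg.index_criterion_of_pos hε hL hν.neg hp, stabilityIndex_neg hε,
      noFlangeContact_neg_iff, abs_neg]

theorem stability_criterion (hε : 0 < ε) (hL : 0 < L) (h : IsPerversion ε L θ)
    (hν : HasParameter ε L θ ν) (he : IsEquilibrium ε L U₀ θ) :
    (IsStable ε L U₀ θ ∧ NoFlangeContact L θ) ↔ Admissible ε L ν := by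
  rcases h.slope_half_pos_or hL with hp | hp
  · exact h.stability_criterion_of_pos hε hL hν hp he
  · rw [← h.neg.stability_criterion_of_pos hε hL hν.neg hp he.neg, isStable_neg_iff,
      noFlangeContact_neg_iff]

theorem slope_zero (hε : 0 < ε) (hL : 0 < L) (h : IsPerversion ε L θ)
    (hν : HasParameter ε L θ ν) : slope L θ 0 = slope L θ L := by
  rcases h.slope_half_pos_or hL with hp | hp
  · exact h.slope_zero_eq hε hL hν hp
  · have := h.neg.slope_zero_eq hε hL hν.neg hp
    rwa [slope_neg, slope_neg, neg_inj] at this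

theorem isEquilibrium_iff_slope_eq (hε : 0 < ε) (hL : 0 < L) (h : IsPerversion ε L θ)
    (hν : HasParameter ε L θ ν) : IsEquilibrium ε L U₀ θ ↔ slope L θ L = U₀ :=
  ⟨fun he => he.2.2, fun he => ⟨h.1, (h.slope_zero hε hL hν).trans he, he⟩⟩

/-- Fixes the sign of the end slope, which the squared equilibrium equation leaves undetermined. -/
theorem slope_mul_apply_nonneg (hL : 0 < L) (h : IsPerversion ε L θ) :
    0 ≤ slope L θ L * θ L := by
  have hmem : L ∈ Icc 0 L := ⟨hL.le, le_rfl⟩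
  rcases h.slope_half_pos_or hL with hp | hp
  · exact mul_nonneg (h.slope_nonneg hL hp hmem) (h.apply_pos hL hp).le
  · have := mul_nonneg (h.neg.slope_nonneg hL hp hmem) (h.neg.apply_pos hL hp).le
    rwa [slope_neg, neg_mul_neg] at this

theorem apply_ne_zero (hL : 0 < L) (h : IsPerversion ε L θ) : θ L ≠ 0 := by
  rcases h.slope_half_pos_or hL with hp | hp
  · exact (h.apply_pos hL hp).ne'
  · have := h.neg.apply_pos hL hp
    linarith

theorem cos_apply_sq (hε : 0 < ε) (hL : 0 < L) (h : IsPerversion ε L θ)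
    (hν : HasParameter ε L θ ν) : Real.cos (θ L) ^ 2 =
      jacobiCn (Real.sqrt ε * L * Real.sqrt (1 + ν)) (1 / (1 + ν)) ^ 2 := by
  rcases h.slope_half_pos_or hL with hp | hp
  · obtain ⟨-, -, -, -, hcn, -⟩ := h.exists_isPendulum hε hL hν hp
    exact hcn
  · obtain ⟨-, -, -, -, hcn, -⟩ := h.neg.exists_isPendulum hε hL hν.neg hp
    rwa [Real.cos_neg] at hcn

theorem equilibriumEquation_iff (hε : 0 < ε) (hL : 0 < L) (h : IsPerversion ε L θ)
    (hν : HasParameter ε L θ ν) : EquilibriumEquation ε L U₀ ν ↔ slope L θ L ^ 2 = U₀ ^ 2 := by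
  rw [EquilibriumEquation, ← h.cos_apply_sq hε hL hν, hν.slope_sq hε ⟨hL.le, le_rfl⟩,
    eq_div_iff (by positivity), mul_comm]

theorem isEquilibrium_iff (hε : 0 < ε) (hL : 0 < L) (h : IsPerversion ε L θ)
    (hν : HasParameter ε L θ ν) :
    IsEquilibrium ε L U₀ θ ↔ EquilibriumEquation ε L U₀ ν ∧ 0 ≤ U₀ * θ L := by
  rw [h.isEquilibrium_iff_slope_eq hε hL hν, h.equilibriumEquation_iff hε hL hν]
  have hnn := h.slope_mul_apply_nonneg hL
  constructor
  · rintro rfl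
    exact ⟨rfl, hnn⟩
  · rintro ⟨h1, h2⟩
    rcases sq_eq_sq_iff_eq_or_eq_neg.1 h1 with h3 | h3
    · exact h3
    · rw [h3] at hnn
      have : U₀ * θ L = 0 := by linarith
      have hU : U₀ = 0 := (mul_eq_zero.1 this).resolve_right (h.apply_ne_zero hL)
      rw [h3, hU, neg_zero]

theorem isEquilibrium_or_neg_iff (hε : 0 < ε) (hL : 0 < L) (h : IsPerversion ε L θ)
    (hν : HasParameter ε L θ ν) :
    (IsEquilibrium ε L U₀ θ ∨ IsEquilibrium ε L U₀ (fun R => -θ R)) ↔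
      EquilibriumEquation ε L U₀ ν := by
  rw [h.isEquilibrium_iff_slope_eq hε hL hν, h.neg.isEquilibrium_iff_slope_eq hε hL hν.neg,
    h.equilibriumEquation_iff hε hL hν, slope_neg, sq_eq_sq_iff_eq_or_eq_neg, neg_eq_iff_eq_neg]

end IsPerversion

theorem IsPendulum.isSolution {Φ P : ℝ → ℝ} (hL : 0 < L) (h : IsPendulum ε Φ P) :
    IsSolution ε L Φ :=
  ⟨fun R _ => (h.hasDerivAt R).differentiableAt.differentiableWithinAt, fun R hR =>
    (h.hasDerivAt' R).hasDerivWithinAt.congr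
      (fun x hx => slope_eq_of_hasDerivAt hL (h.hasDerivAt x) hx)
      (slope_eq_of_hasDerivAt hL (h.hasDerivAt R) hR)⟩

theorem exists_isPerversion (hε : 0 < ε) (hL : 0 < L) (hν : 0 < ν) :
    ∃ θ : ℝ → ℝ, IsPerversion ε L θ ∧ HasParameter ε L θ ν := by
  obtain ⟨Φ, P, hΦ, h0, h1, -, hpos⟩ := exists_isPendulum hε (show -1 < ν by linarith)
  obtain ⟨hodd, hP, -⟩ := hpos hν
  have hΨ := hΦ.comp_add (-(L / 2))
  have hmem : L / 2 ∈ Icc 0 L := ⟨by linarith, by linarith⟩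
  have hslope : ∀ R ∈ Icc 0 L, slope L (fun x => Φ (x + -(L / 2))) R = P (R + -(L / 2)) :=
    fun R hR => slope_eq_of_hasDerivAt hL (hΨ.hasDerivAt R) hR
  have hper : IsPerversion ε L (fun x => Φ (x + -(L / 2))) := by
    refine ⟨hΨ.isSolution hL, fun R _ => ?_, fun R hR => ?_⟩
    · exact (congrArg Φ (by ring)).trans (hodd (R + -(L / 2)))
    · rw [hslope R (Ioo_subset_Icc_self hR)]
      exact (hP _).ne'
  refine ⟨_, hper, ?_⟩
  obtain ⟨ν', hν'⟩ := hper.1.exists_hasParameter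
  have e1 := hper.slope_half_sq hε hL hν'
  rw [hslope _ hmem, add_neg_cancel, h1, mul_pow, mul_pow, Real.sq_sqrt hε.le,
    Real.sq_sqrt (by linarith)] at e1
  have e2 : 4 * ε * (ν - ν') = 0 := by linarith
  have e3 : ν - ν' = 0 := (mul_eq_zero.1 e2).resolve_left (by positivity)
  rwa [sub_eq_zero.1 e3]

theorem exists_stable_iff (hε : 0 < ε) (hL : 0 < L) (U₀ ν : ℝ) :
    (∃ θ : ℝ → ℝ, IsPerversion ε L θ ∧ HasParameter ε L θ ν ∧
      IsStable ε L U₀ θ ∧ NoFlangeContact L θ) ↔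
    EquilibriumEquation ε L U₀ ν ∧ Admissible ε L ν := by
  constructor
  · rintro ⟨θ, h, hν, hs, hn⟩
    exact ⟨((h.isEquilibrium_iff hε hL hν).1 hs.1).1,
      (h.stability_criterion hε hL hν hs.1).1 ⟨hs, hn⟩⟩
  · rintro ⟨he, ha⟩
    obtain ⟨θ, h, hν⟩ := exists_isPerversion hε hL ha.1
    rcases (h.isEquilibrium_or_neg_iff hε hL hν).2 he with h1 | h1
    · exact ⟨θ, h, hν, (h.stability_criterion hε hL hν h1).2 ha⟩
    · exact ⟨_, h.neg, hν.neg, (h.neg.stability_criterion hε hL hν.neg h1).2 ha⟩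

end Ladder

end

theorem mainTheorem3 (ε L U₀ : ℝ) (hε : 0 < ε) (hL : 0 < L) :
    -- every perversion has a pseudo-energy parameter
    (∀ θ : ℝ → ℝ, Ladder.IsPerversion ε L θ →
      ∃ ν : ℝ, -1 < ν ∧ Ladder.HasParameter ε L θ ν) ∧
    -- criteria for a perversion with parameter `ν`
    (∀ (θ : ℝ → ℝ) (ν : ℝ), Ladder.IsPerversion ε L θ → Ladder.HasParameter ε L θ ν →
      -- equilibrium, for the given orientation and up to the reflection `θ ↦ -θ`
      (Ladder.IsEquilibrium ε L U₀ θ ↔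
        Ladder.EquilibriumEquation ε L U₀ ν ∧ 0 ≤ U₀ * θ L) ∧
      ((Ladder.IsEquilibrium ε L U₀ θ ∨ Ladder.IsEquilibrium ε L U₀ (fun R => -θ R)) ↔
        Ladder.EquilibriumEquation ε L U₀ ν) ∧
      -- stability index, the degenerate amplitude `π / 2` being excluded
      ((Ladder.stabilityIndex ε L θ = -1 ∧ |θ L| ≠ Real.pi / 2 ∧ Ladder.NoFlangeContact L θ) ↔
        Ladder.Admissible ε L ν) ∧
      -- stability of equilibria
      (Ladder.IsEquilibrium ε L U₀ θ →
        ((Ladder.IsStable ε L U₀ θ ∧ Ladder.NoFlangeContact L θ) ↔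
          Ladder.Admissible ε L ν))) ∧
    -- monotonicity of `k`, and the interval of admissible parameters
    StrictAntiOn Ladder.k (Set.Ioi 0) ∧
    (∃ ν₁ ν₂ : ℝ, 0 < ν₁ ∧ ν₁ < ν₂ ∧
      Ladder.k ν₁ = Real.sqrt ε * L ∧ Ladder.k ν₂ = Real.sqrt ε * L / 2 ∧
      {ν : ℝ | Ladder.Admissible ε L ν} = Set.Ioo ν₁ ν₂) ∧
    -- existence of stable perversions
    (∀ ν : ℝ,
      (∃ θ : ℝ → ℝ, Ladder.IsPerversion ε L θ ∧ Ladder.HasParameter ε L θ ν ∧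
        Ladder.IsStable ε L U₀ θ ∧ Ladder.NoFlangeContact L θ) ↔
      Ladder.EquilibriumEquation ε L U₀ ν ∧ Ladder.Admissible ε L ν) := by
  refine ⟨fun θ h => ?_, fun θ ν h hν => ⟨h.isEquilibrium_iff hε hL hν,
    h.isEquilibrium_or_neg_iff hε hL hν, h.index_criterion hε hL hν,
    h.stability_criterion hε hL hν⟩, Ladder.k_strictAntiOn,
    Ladder.exists_admissible_interval hε hL, Ladder.exists_stable_iff hε hL U₀⟩
  obtain ⟨ν, hν⟩ := h.1.exists_hasParameter
  exact ⟨ν, h.neg_one_lt hε hL hν, hν⟩
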